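/- **Setting.** For every $N\ge 1$ let $W_N$ be a random real symmetric $N\times N$ matrix whose entries $(W_N)_{jk}$, $1\le j\le k\le N$, are independent, with $$\mathbb E (W_N)_{jk}=0,\quad \mathbb V (W_N)_{jk}=\sigma^2,\quad \mathbb E (W_N)_{jk}^4\le m_4<\infty\qquad (j\ne k),$$ $$\mathbb E (W_N)_{jj}=0,\quad \mathbb E (W_N)_{jj}^2\le\sigma_1^2<\infty ,$$ where $\sigma,\sigma_1,m_4$ do not depend on $N,j,k$ (such a sequence is called a real symmetric Wigner matrix with parameter $\sigma$). Let $m$ be a positive integer such that for all $1\le i\le m$ and all $\epsilon>0$ $$\frac1N\sum_{j:\,j\ne i}\mathbb E\Big(|(W_N)_{ij}|^4\,\mathbf 1_{\{|(W_N)_{ij}|\ge \epsilon N^{1/4}\}}\Big)\longrightarrow 0\qquad (N\to\infty).\tag{$A_1$}$$ **Proposition.** There is a polynomial $P_4$ of degree $4$ with positive coefficients (a universal one), and for all $\sigma,\sigma_1,m_4$ there is a constant $C>0$ depending only on $\sigma,\sigma_1,m_4$, such that the following holds for every $m$ and every $(W_N)$ as above. After enlarging the probability spaces if necessary, there exist a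 random real symmetric Wigner matrix $T_N$ with the same parameter $\sigma$ (on the same probability space as $W_N$), and non-random $\epsilon_N>0$ with $\epsilon_N\to 0$, such that 1. $(T_N)_{jk}=(W_N)_{jk}$ for $m+1\le j,k\le N$; 2. $\mathbb P\big((T_N)_{ik}=(W_N)_{ik}\ \text{for all}\ 1\le i\le m,\ 1\le k\le N\big)\to 1$ as $N\to\infty$; 3. $\mathbb E (T_N)_{ik}=0$ for $1\le i\le m$, $1\le k\le N$; 4. $\mathbb V (T_N)_{ik}=\sigma^2$ for $1\le i\le m$, $1\le k\le N$, $i\neq k$, and $\sup_{1\le i\le m,\,N}\mathbb V (T_N)_{ii}<\infty$; 5. $\sup_{N,\ 1\le i\le m,\ 1\le k\le N,\ k\ne i}\mathbb E (T_N)_{ik}^4<\infty$; 6. $|(T_N)_{ik}|\le \epsilon_N N^{1/4}$ for $1\le i\le m$, $1\le k\le N$; and, with $G_N(z)=\big(zI_N-\tfrac1{\sqrt N}T_N\big)^{-1}$, with $\|\cdot\|$ the operator norm for the Euclidean norm on $\mathbb C^N$, and with $\mathbb V\xi=\mathbb E|\xi-\mathbb E\xi|^2$ for complex $\xi$, $$\mathbb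 V\big[(G_N(z))_{ij}\big]\le C\,\frac{\mathbb E\|G_N(z)\|^2\;P_4(|\Im z|^{-1})}{N}+C\,\frac{\mathbb E\|G_N(z)\|^{3/2}\;P_4(|\Im z|^{-1})}{N}$$ for all $N\ge1$, all $z\in\mathbb C\setminus\mathbb R$, all $1\le i\le m$ with $i\le N$, and all $1\le j\le N$. -/

import Mathlib

open MeasureTheory ProbabilityTheory Filter Topology

universe u

namespace WignerResolvent

/-- The sequence `W N`, `N = 0, 1, 2, …`, consists of random real symmetric Wigner matrices
(before normalization); `W N` is an `N × N` matrix on its own probability space `(Ω N, P N)`.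
The entries on and above the diagonal are independent; the off-diagonal ones are centred, with
variance `σ ^ 2` and fourth moments at most `m₄`; the diagonal ones are centred, with second
moments at most `σ₁ ^ 2`. The bounds `m₄`, `σ₁` are uniform in `N` and in the entry, so they are
finite upper bounds of the suprema of these moments. -/
structure IsWigner {Ω : ℕ → Type u} [∀ N, MeasurableSpace (Ω N)] (P : ∀ N, Measure (Ω N))
    (W : ∀ N, Ω N → Matrix (Fin N) (Fin N) ℝ) (σ σ₁ m₄ : ℝ) : Prop where
  measurable_entry : ∀ (N : ℕ) (j k : Fin N), Measurable fun ω => W N ω j k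
  isSymm : ∀ (N : ℕ) (ω : Ω N), (W N ω).IsSymm
  indep : ∀ N : ℕ,
    iIndepFun (fun (p : {p : Fin N × Fin N // p.1 ≤ p.2}) ω => W N ω p.1.1 p.1.2) (P N)
  offDiag_memLp : ∀ (N : ℕ) (j k : Fin N), j ≠ k → MemLp (fun ω => W N ω j k) 4 (P N)
  offDiag_mean : ∀ (N : ℕ) (j k : Fin N), j ≠ k → ∫ ω, W N ω j k ∂(P N) = 0
  offDiag_variance : ∀ (N : ℕ) (j k : Fin N), j ≠ k →
    variance (fun ω => W N ω j k) (P N) = σ ^ 2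
  offDiag_fourth : ∀ (N : ℕ) (j k : Fin N), j ≠ k → ∫ ω, (W N ω j k) ^ 4 ∂(P N) ≤ m₄
  diag_memLp : ∀ (N : ℕ) (j : Fin N), MemLp (fun ω => W N ω j j) 2 (P N)
  diag_mean : ∀ (N : ℕ) (j : Fin N), ∫ ω, W N ω j j ∂(P N) = 0
  diag_second : ∀ (N : ℕ) (j : Fin N), ∫ ω, (W N ω j j) ^ 2 ∂(P N) ≤ σ₁ ^ 2

/-- The Lindeberg functional of row `i` (rows are numbered from `0`):
`N⁻¹ ∑_{j ≠ i} E (|W i j| ^ 4 ; |W i j| ≥ ε N ^ (1/4))`.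
It is set to `0` for the finitely many `N` for which row `i` does not exist. -/
noncomputable def rowLindeberg {Ω : ℕ → Type u} [∀ N, MeasurableSpace (Ω N)]
    (P : ∀ N, Measure (Ω N)) (W : ∀ N, Ω N → Matrix (Fin N) (Fin N) ℝ)
    (i : ℕ) (ε : ℝ) (N : ℕ) : ℝ :=
  if h : i < N then
    (1 / (N : ℝ)) * ∑ j ∈ Finset.univ.erase (⟨i, h⟩ : Fin N),
      ∫ ω in {ω | ε * (N : ℝ) ^ (1 / 4 : ℝ) ≤ |W N ω ⟨i, h⟩ j|}, |W N ω ⟨i, h⟩ j| ^ 4 ∂(P N)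
  else 0

/-- `T` is a modification of the Wigner matrices `W` in the first `m` rows and columns, with
truncation levels `ε N * N ^ (1/4)`. Both sequences live on the same probability spaces. -/
structure IsRowTruncation {Ω : ℕ → Type u} [∀ N, MeasurableSpace (Ω N)] (P : ∀ N, Measure (Ω N))
    (W T : ∀ N, Ω N → Matrix (Fin N) (Fin N) ℝ) (σ : ℝ) (m : ℕ) (ε : ℕ → ℝ) : Prop where
  isWigner : ∃ σ₁ m₄ : ℝ, IsWigner P T σ σ₁ m₄
  eps_pos : ∀ N, 0 < ε N
  eps_tendsto : Tendsto ε atTop (𝓝 0)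
  eq_of_ge : ∀ (N : ℕ) (ω : Ω N) (j k : Fin N), m ≤ (j : ℕ) → m ≤ (k : ℕ) →
    T N ω j k = W N ω j k
  tendsto_prob : Tendsto
    (fun N => P N {ω | ∀ i k : Fin N, (i : ℕ) < m → T N ω i k = W N ω i k}) atTop (𝓝 1)
  mean : ∀ (N : ℕ) (i k : Fin N), (i : ℕ) < m → ∫ ω, T N ω i k ∂(P N) = 0
  variance_offDiag : ∀ (N : ℕ) (i k : Fin N), (i : ℕ) < m → i ≠ k →
    variance (fun ω => T N ω i k) (P N) = σ ^ 2
  variance_diag : ∃ c : ℝ, ∀ (N : ℕ) (i : Fin N), (i : ℕ) < m →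
    variance (fun ω => T N ω i i) (P N) ≤ c
  fourth_offDiag : ∃ c : ℝ, ∀ (N : ℕ) (i k : Fin N), (i : ℕ) < m → i ≠ k →
    ∫ ω, (T N ω i k) ^ 4 ∂(P N) ≤ c
  abs_le : ∀ (N : ℕ) (ω : Ω N) (i k : Fin N), (i : ℕ) < m →
    |T N ω i k| ≤ ε N * (N : ℝ) ^ (1 / 4 : ℝ)

/-- The resolvent `(z I - N^{-1/2} A)⁻¹` of the normalized matrix `N^{-1/2} A`. -/
noncomputable def resolventMatrix {N : ℕ} (A : Matrix (Fin N) (Fin N) ℝ) (z : ℂ) :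
    Matrix (Fin N) (Fin N) ℂ :=
  (z • (1 : Matrix (Fin N) (Fin N) ℂ) - (((1 / Real.sqrt N) • A).map fun x : ℝ => (x : ℂ)))⁻¹

/-- The operator norm of a complex matrix for the Euclidean norm on `ℂ ^ N`. -/
noncomputable def opNorm {N : ℕ} (A : Matrix (Fin N) (Fin N) ℂ) : ℝ :=
  ‖Matrix.toEuclideanCLM (n := Fin N) (𝕜 := ℂ) A‖

/-- The variance `E |ξ - E ξ| ^ 2` of a complex random variable. -/
noncomputable def cVariance {Ω : Type u} [MeasurableSpace Ω] (P : Measure Ω) (ξ : Ω → ℂ) : ℝ :=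
  ∫ ω, ‖ξ ω - ∫ ω', ξ ω' ∂P‖ ^ 2 ∂P

end WignerResolvent

/-! The truncation and the variance bound are separate arguments, joined only by the fact that the
truncated matrix is again Wigner with the same `σ`, `σ₁` and with fourth moments at most `8 * m₄`.

Truncation. An entry `x` with `E x² ≤ L²` is kept when `|x| ≤ L`, except that a coin discards it
anyway with probability `q = E(x²; |x| > L) / L²`. Discarded values become `± y` with a biased sign.
The extra discarding gives the atoms `± y` mass at least `q`, enough to carry the lost second moment
with `y ≤ 2L`; then `y` and the bias restore both moments exactly (`exists_twoPoint`,
`exists_truncation`). The entry changes with probability at most `2q`, and off the diagonal `q ≤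
E(x⁴; |x| ≥ L) / L⁴`. With `L = ε N^(1/4)` a union bound over a row gives the Lindeberg functional
divided by `ε⁴`, which tends to zero when `ε` decreases slowly (`exists_truncation_levels`). The
coins are independent across entries, so the modified entries remain independent.

Variance. By the Efron–Stein inequality (`efronStein`) the variance of `G i j` is at most the sum,
over the entries on and above the diagonal, of the mean square change when that entry is set to `0`.
With `G'` the frozen resolvent, the resolvent identity gives the change `N^(-1/2) x (G' i k * G l j
+ G' i l * G k j)`. Since `G'` depends on the frozen position, its entries cannot be summed
directly. So one first replaces `G` by `G'`, at the cost of a term of order `x⁴ / N²`, uses that `x`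
is independent of `G'`, and then returns from `G'` to `G` inside the expectations. The return is an
absorption argument valid for `N ≥ 16 s |Im z|⁻²`, where `s` bounds the second moments; for smaller
`N` the bound is trivial. The sums over `k, l` are then controlled by rows and columns of `G`, which
gives `E ‖G‖² / N` times a combination of `|Im z|⁻²` and `|Im z|⁻⁴`. The term with exponent `3/2` is
nonnegative and not needed. -/

namespace WignerResolvent

/-! ### Resolvent bounds off the real axis -/

/-- The matrix whose inverse is the resolvent. -/
noncomputable def resolventInv {N : ℕ} (A : Matrix (Fin N) (Fin N) ℝ) (z : ℂ) :
    Matrix (Fin N) (Fin N) ℂ :=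
  z • (1 : Matrix (Fin N) (Fin N) ℂ) - (((1 / Real.sqrt N) • A).map fun x : ℝ => (x : ℂ))

theorem resolventMatrix_eq {N : ℕ} (A : Matrix (Fin N) (Fin N) ℝ) (z : ℂ) :
    resolventMatrix A z = (resolventInv A z)⁻¹ := rfl

/-- With `B` the normalized Hermitian matrix, `⟨v, B v⟩` is real, so `⟨v, (z - B) v⟩` has imaginary
part `Im z * ‖v‖²`; Cauchy–Schwarz concludes. Both invertibility and the norm bound of the resolvent
follow from this. -/
theorem mul_norm_le_norm_toEuclideanCLM_resolventInv {N : ℕ} {A : Matrix (Fin N) (Fin N) ℝ}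
    (hA : A.IsSymm) (z : ℂ) (v : EuclideanSpace ℂ (Fin N)) :
    |z.im| * ‖v‖ ≤ ‖Matrix.toEuclideanCLM (n := Fin N) (𝕜 := ℂ) (resolventInv A z) v‖ := by
  set B : Matrix (Fin N) (Fin N) ℂ := ((1 / Real.sqrt N) • A).map fun x : ℝ => (x : ℂ) with hB
  have hBH : B.IsHermitian := by
    ext a b
    have := congrFun (congrFun hA a) b
    simp only [Matrix.transpose_apply] at this
    simp [hB, Matrix.conjTranspose_apply, this]
  have hsa : IsSelfAdjoint (Matrix.toEuclideanCLM (n := Fin N) (𝕜 := ℂ) B) := by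
    have hB' : IsSelfAdjoint B := hBH
    exact hB'.map (Matrix.toEuclideanCLM (n := Fin N) (𝕜 := ℂ))
  have him : (inner ℂ v (Matrix.toEuclideanCLM (n := Fin N) (𝕜 := ℂ) B v)).im = 0 := by
    have h1 := hsa.isSymmetric v v
    have h2 := inner_conj_symm (𝕜 := ℂ) v (Matrix.toEuclideanCLM (n := Fin N) (𝕜 := ℂ) B v)
    rw [ContinuousLinearMap.coe_coe] at h1
    rw [h1] at h2
    exact Complex.conj_eq_iff_im.mp h2
  have hexp : Matrix.toEuclideanCLM (n := Fin N) (𝕜 := ℂ) (resolventInv A z) v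
      = z • v - Matrix.toEuclideanCLM (n := Fin N) (𝕜 := ℂ) B v := by
    rw [resolventInv, map_sub, map_smul, map_one]
    rfl
  have hin : (inner ℂ v (Matrix.toEuclideanCLM (n := Fin N) (𝕜 := ℂ) (resolventInv A z) v)).im
      = z.im * ‖v‖ ^ 2 := by
    rw [hexp, inner_sub_right, inner_smul_right, Complex.sub_im, him, inner_self_eq_norm_sq_to_K,
      sub_zero]
    simp [← Complex.ofReal_pow]
  rcases eq_or_ne v 0 with rfl | hv
  · simp
  have hv' : 0 < ‖v‖ := norm_pos_iff.mpr hv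
  have h3 : |z.im| * ‖v‖ ^ 2 ≤
      ‖v‖ * ‖Matrix.toEuclideanCLM (n := Fin N) (𝕜 := ℂ) (resolventInv A z) v‖ := by
    calc |z.im| * ‖v‖ ^ 2 = |z.im * ‖v‖ ^ 2| := by rw [abs_mul, abs_of_nonneg (sq_nonneg ‖v‖)]
      _ ≤ _ := by
        rw [← hin]
        exact (Complex.abs_im_le_norm _).trans (norm_inner_le_norm _ _)
  nlinarith

theorem isUnit_det_resolventInv {N : ℕ} {A : Matrix (Fin N) (Fin N) ℝ}
    (hA : A.IsSymm) {z : ℂ} (hz : z.im ≠ 0) : IsUnit (resolventInv A z).det := by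
  rw [isUnit_iff_ne_zero]
  intro h
  obtain ⟨v, hv, hv0⟩ := Matrix.exists_mulVec_eq_zero_iff.mpr h
  have h1 := mul_norm_le_norm_toEuclideanCLM_resolventInv hA z (WithLp.toLp 2 v)
  rw [Matrix.toEuclideanCLM_toLp, hv0] at h1
  simp only [WithLp.toLp_zero, norm_zero] at h1
  have h2 : 0 < |z.im| := abs_pos.mpr hz
  have h3 : ‖WithLp.toLp 2 v‖ ≤ 0 := by
    by_contra! h4
    nlinarith [mul_pos h2 h4]
  apply hv
  have h5 := norm_le_zero_iff.mp h3
  simpa using h5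

theorem opNorm_nonneg {N : ℕ} (M : Matrix (Fin N) (Fin N) ℂ) : 0 ≤ opNorm M := norm_nonneg _

theorem opNorm_resolventMatrix_le {N : ℕ} {A : Matrix (Fin N) (Fin N) ℝ}
    (hA : A.IsSymm) {z : ℂ} (hz : z.im ≠ 0) : opNorm (resolventMatrix A z) ≤ |z.im|⁻¹ := by
  have h2 : 0 < |z.im| := abs_pos.mpr hz
  refine ContinuousLinearMap.opNorm_le_bound _ (by positivity) fun v => ?_
  have h1 := mul_norm_le_norm_toEuclideanCLM_resolventInv hA z
    (Matrix.toEuclideanCLM (n := Fin N) (𝕜 := ℂ) (resolventMatrix A z) v)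
  have h3 : Matrix.toEuclideanCLM (n := Fin N) (𝕜 := ℂ) (resolventInv A z)
      (Matrix.toEuclideanCLM (n := Fin N) (𝕜 := ℂ) (resolventMatrix A z) v) = v := by
    rw [← mul_apply_eq_comp, ← map_mul, resolventMatrix_eq,
      Matrix.mul_nonsing_inv _ (isUnit_det_resolventInv hA hz), map_one]
    rfl
  rw [h3] at h1
  rw [inv_mul_eq_div, le_div_iff₀ h2, mul_comm]
  exact h1

/-- Column `j` is the image of a unit basis vector. Rows of the resolvent reduce to columns because
it is symmetric for the plain transpose. -/
theorem sum_norm_sq_col_le_opNorm_sq {N : ℕ} (M : Matrix (Fin N) (Fin N) ℂ) (j : Fin N) :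
    ∑ k, ‖M k j‖ ^ 2 ≤ opNorm M ^ 2 := by
  have h := (Matrix.toEuclideanCLM (n := Fin N) (𝕜 := ℂ) M).le_opNorm (EuclideanSpace.single j 1)
  simp only [PiLp.norm_single, norm_one, mul_one] at h
  have h2 : ‖Matrix.toEuclideanCLM (n := Fin N) (𝕜 := ℂ) M (EuclideanSpace.single j 1)‖ ^ 2
      = ∑ k, ‖M k j‖ ^ 2 := by
    rw [EuclideanSpace.norm_sq_eq]
    refine Finset.sum_congr rfl fun k _ => ?_
    rw [Matrix.ofLp_toEuclideanCLM]
    simp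
  rw [← h2]
  exact pow_le_pow_left₀ (norm_nonneg _) h 2

theorem norm_apply_le_opNorm {N : ℕ} (M : Matrix (Fin N) (Fin N) ℂ) (i j : Fin N) :
    ‖M i j‖ ≤ opNorm M := by
  refine le_of_sq_le_sq ?_ (opNorm_nonneg M)
  exact (Finset.single_le_sum (f := fun k => ‖M k j‖ ^ 2) (fun k _ => sq_nonneg _)
    (Finset.mem_univ i)).trans (sum_norm_sq_col_le_opNorm_sq M j)

theorem resolventMatrix_isSymm {N : ℕ} {A : Matrix (Fin N) (Fin N) ℝ}
    (hA : A.IsSymm) (z : ℂ) : (resolventMatrix A z).IsSymm := by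
  unfold Matrix.IsSymm
  rw [resolventMatrix_eq, Matrix.transpose_nonsing_inv]
  congr 1
  ext a b
  have := congrFun (congrFun hA a) b
  simp only [Matrix.transpose_apply] at this
  simp [resolventInv, Matrix.one_apply, eq_comm, this]

theorem sum_norm_sq_row_le_opNorm_sq {N : ℕ} {A : Matrix (Fin N) (Fin N) ℝ}
    (hA : A.IsSymm) (z : ℂ) (i : Fin N) :
    ∑ k, ‖resolventMatrix A z i k‖ ^ 2 ≤ opNorm (resolventMatrix A z) ^ 2 := by
  simp_rw [← (resolventMatrix_isSymm hA z).apply i]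
  exact sum_norm_sq_col_le_opNorm_sq _ i

theorem resolventMatrix_sub {N : ℕ} {A B : Matrix (Fin N) (Fin N) ℝ}
    (hA : A.IsSymm) (hB : B.IsSymm) {z : ℂ} (hz : z.im ≠ 0) :
    resolventMatrix A z - resolventMatrix B z =
      resolventMatrix B z * (((1 / Real.sqrt N) • (A - B)).map fun x : ℝ => (x : ℂ)) *
        resolventMatrix A z := by
  have h : (((1 / Real.sqrt N) • (A - B)).map fun x : ℝ => (x : ℂ))
      = resolventInv B z - resolventInv A z := by
    ext a b
    simp [resolventInv]
    ring
  rw [h, resolventMatrix_eq, resolventMatrix_eq, Matrix.mul_sub, Matrix.sub_mul,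
    Matrix.nonsing_inv_mul _ (isUnit_det_resolventInv hB hz), Matrix.mul_assoc,
    Matrix.mul_nonsing_inv _ (isUnit_det_resolventInv hA hz), Matrix.one_mul, Matrix.mul_one]

/-! ### The resolvent as a function of the independent entries -/

/-- The positions on and above the diagonal. -/
abbrev UpperIndex (N : ℕ) : Type := {p : Fin N × Fin N // p.1 ≤ p.2}

/-- The symmetric matrix with given entries on and above the diagonal. -/
def symMatrix {N : ℕ} (x : UpperIndex N → ℝ) : Matrix (Fin N) (Fin N) ℝ := fun j k =>
  if h : j ≤ k then x ⟨(j, k), h⟩ else x ⟨(k, j), (not_le.mp h).le⟩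

theorem symMatrix_isSymm {N : ℕ} (x : UpperIndex N → ℝ) : (symMatrix x).IsSymm := by
  ext j k
  simp only [Matrix.transpose_apply, symMatrix]
  rcases lt_trichotomy j k with h | h | h
  · simp [h.le, not_le.mpr h]
  · subst h; simp
  · simp [h.le, not_le.mpr h]

theorem symMatrix_of_isSymm {N : ℕ} {A : Matrix (Fin N) (Fin N) ℝ} (hA : A.IsSymm) :
    symMatrix (fun p : UpperIndex N => A p.1.1 p.1.2) = A := by
  ext j k
  unfold symMatrix
  split_ifs
  · rfl
  · exact hA.apply j k

theorem symMatrix_sub_update {N : ℕ} (x : UpperIndex N → ℝ) (p : UpperIndex N) :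
    symMatrix x - symMatrix (Function.update x p 0) =
      if p.1.1 = p.1.2 then Matrix.single p.1.1 p.1.1 (x p)
      else Matrix.single p.1.1 p.1.2 (x p) + Matrix.single p.1.2 p.1.1 (x p) := by
  obtain ⟨⟨k, l⟩, hkl⟩ := p
  have hkl' : k ≤ l := hkl
  ext a b
  rw [Matrix.sub_apply]
  by_cases h1 : k = a ∧ l = b
  · obtain ⟨rfl, rfl⟩ := h1
    by_cases hd : k = l
    · subst hd
      simp [symMatrix]
    · simp [symMatrix, hkl', hd, Ne.symm hd]
  by_cases h2 : k = b ∧ l = a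
  · obtain ⟨rfl, rfl⟩ := h2
    have hd : k ≠ l := fun h => h1 ⟨h, h.symm⟩
    have hlk : ¬ l ≤ k := fun h => hd (le_antisymm hkl' h)
    simp [symMatrix, hlk, hd]
  have h3 : symMatrix (Function.update x ⟨(k, l), hkl⟩ 0) a b = symMatrix x a b := by
    unfold symMatrix
    split_ifs
    · rw [Function.update_of_ne]
      simp only [ne_eq, Subtype.mk.injEq, Prod.mk.injEq]
      exact fun h => h1 ⟨h.1.symm, h.2.symm⟩
    · rw [Function.update_of_ne]
      simp only [ne_eq, Subtype.mk.injEq, Prod.mk.injEq]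
      exact fun h => h2 ⟨h.1.symm, h.2.symm⟩
  rw [h3, sub_self]
  by_cases hd : k = l
  · subst hd
    rw [if_pos rfl, Matrix.single_apply, if_neg h1]
  · rw [if_neg hd, Matrix.add_apply, Matrix.single_apply, Matrix.single_apply, if_neg h1, if_neg,
      add_zero]
    exact fun h => h2 ⟨h.2, h.1⟩

theorem continuous_symMatrix {N : ℕ} : Continuous (symMatrix (N := N)) := by
  refine continuous_matrix fun j k => ?_
  unfold symMatrix
  split_ifs
  · exact continuous_apply _
  · exact continuous_apply _

/-- Cramer's rule: adjugate over a determinant that does not vanish off the real axis. This supplies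
the measurability used throughout. -/
theorem continuous_resolventMatrix_symMatrix {N : ℕ} {z : ℂ} (hz : z.im ≠ 0) :
    Continuous fun x : UpperIndex N → ℝ => resolventMatrix (symMatrix x) z := by
  have hs : Continuous fun x : UpperIndex N → ℝ => (1 / Real.sqrt N) • symMatrix x :=
    continuous_symMatrix.const_smul (1 / Real.sqrt N)
  have hc : Continuous fun x : UpperIndex N → ℝ => resolventInv (symMatrix x) z := by
    unfold resolventInv
    exact continuous_const.sub (hs.matrix_map Complex.continuous_ofReal)
  simp_rw [resolventMatrix_eq, Matrix.inv_def, Ring.inverse_eq_inv']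
  exact (hc.matrix_det.inv₀ fun x =>
    (isUnit_det_resolventInv (symMatrix_isSymm x) hz).ne_zero).smul hc.matrix_adjugate

theorem continuous_opNorm {N : ℕ} : Continuous (opNorm (N := N)) := by
  unfold opNorm
  exact (LinearMap.continuous_of_finiteDimensional
    (Matrix.toEuclideanCLM (n := Fin N) (𝕜 := ℂ)).toAlgEquiv.toLinearMap).norm

/-! ### The Efron–Stein inequality with a frozen coordinate -/

theorem integral_norm_sub_sq_eq {Ω : Type*} [MeasurableSpace Ω] {P : Measure Ω}
    [IsProbabilityMeasure P] {F : Ω → ℂ} {K : ℝ} (hF : Measurable F) (hK : ∀ ω, ‖F ω‖ ≤ K)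
    (c : ℂ) :
    ∫ ω, ‖F ω - c‖ ^ 2 ∂P = ∫ ω, ‖F ω - ∫ ω', F ω' ∂P‖ ^ 2 ∂P + ‖∫ ω', F ω' ∂P - c‖ ^ 2 := by
  set m := ∫ ω', F ω' ∂P with hm
  have hFi : Integrable F P := Integrable.of_bound hF.aestronglyMeasurable K (ae_of_all _ hK)
  have hi1 : Integrable (fun ω => ‖F ω - m‖ ^ 2) P := by
    refine Integrable.of_bound (by fun_prop) ((K + ‖m‖) ^ 2) (ae_of_all _ fun ω => ?_)
    rw [norm_pow, norm_norm]
    exact pow_le_pow_left₀ (norm_nonneg _)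
      ((norm_sub_le _ _).trans (add_le_add_left (hK ω) _)) 2
  have hFm : Integrable (fun ω => F ω - m) P := hFi.sub (integrable_const m)
  have hi2 : Integrable (fun ω => inner ℝ (m - c) (F ω - m)) P := hFm.const_inner (m - c)
  have hi3 : Integrable (fun ω => 2 * inner ℝ (m - c) (F ω - m) + ‖m - c‖ ^ 2) P :=
    (hi2.const_mul 2).add (integrable_const _)
  have h0 : ∫ ω, inner ℝ (m - c) (F ω - m) ∂P = 0 := by
    rw [integral_inner hFm, integral_sub hFi (integrable_const m)]
    simp [← hm]
  have hp : ∀ ω, ‖F ω - c‖ ^ 2 =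
      ‖F ω - m‖ ^ 2 + (2 * inner ℝ (m - c) (F ω - m) + ‖m - c‖ ^ 2) := fun ω => by
    rw [← sub_add_sub_cancel (F ω) m c, norm_add_sq_real, real_inner_comm]
    ring
  simp_rw [hp]
  rw [integral_add hi1 hi3,
    integral_add (hi2.const_mul 2) (integrable_const _), integral_const_mul, h0]
  simp

theorem integral_norm_sub_integral_sq_le {Ω : Type*} [MeasurableSpace Ω] {P : Measure Ω}
    [IsProbabilityMeasure P] {F : Ω → ℂ} {K : ℝ} (hF : Measurable F) (hK : ∀ ω, ‖F ω‖ ≤ K)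
    (c : ℂ) :
    ∫ ω, ‖F ω - ∫ ω', F ω' ∂P‖ ^ 2 ∂P ≤ ∫ ω, ‖F ω - c‖ ^ 2 ∂P := by
  rw [integral_norm_sub_sq_eq hF hK c]
  exact le_add_of_nonneg_right (sq_nonneg _)

theorem norm_integral_sq_le_integral_norm_sq {Ω : Type*} [MeasurableSpace Ω] {P : Measure Ω}
    [IsProbabilityMeasure P] {F : Ω → ℂ} {K : ℝ} (hF : Measurable F) (hK : ∀ ω, ‖F ω‖ ≤ K) :
    ‖∫ ω, F ω ∂P‖ ^ 2 ≤ ∫ ω, ‖F ω‖ ^ 2 ∂P := by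
  have h := integral_norm_sub_sq_eq (P := P) hF hK 0
  simp only [sub_zero] at h
  rw [h]
  exact le_add_of_nonneg_left (integral_nonneg fun _ => sq_nonneg _)

theorem integrable_norm_sub_sq {Ω : Type*} [MeasurableSpace Ω] {P : Measure Ω}
    [IsFiniteMeasure P] {F H : Ω → ℂ} {K : ℝ} (hF : Measurable F) (hH : Measurable H)
    (hFK : ∀ ω, ‖F ω‖ ≤ K) (hHK : ∀ ω, ‖H ω‖ ≤ K) :
    Integrable (fun ω => ‖F ω - H ω‖ ^ 2) P := by
  refine Integrable.of_bound (by fun_prop) ((K + K) ^ 2) (ae_of_all _ fun ω => ?_)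
  rw [norm_pow, norm_norm]
  exact pow_le_pow_left₀ (norm_nonneg _)
    ((norm_sub_le _ _).trans (add_le_add (hFK ω) (hHK ω))) 2

/-- Law of total variance, conditioning on the first coordinate. The variance of the conditional
mean is at most its mean square distance to its value at `a₀`, and Jensen's inequality moves the
square inside the inner integral. -/
theorem variance_prod_le {α β : Type*} [MeasurableSpace α] [MeasurableSpace β]
    {μ : Measure α} {ν : Measure β} [IsProbabilityMeasure μ] [IsProbabilityMeasure ν]
    {F : α × β → ℂ} {K : ℝ} (hF : Measurable F) (hK : ∀ x, ‖F x‖ ≤ K) (a₀ : α) :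
    ∫ x, ‖F x - ∫ y, F y ∂μ.prod ν‖ ^ 2 ∂μ.prod ν ≤
      ∫ x, ‖F x - F (a₀, x.2)‖ ^ 2 ∂μ.prod ν +
        ∫ a, ∫ b, ‖F (a, b) - ∫ b', F (a, b') ∂ν‖ ^ 2 ∂ν ∂μ := by
  have hFi : Integrable F (μ.prod ν) :=
    Integrable.of_bound hF.aestronglyMeasurable K (ae_of_all _ hK)
  set g : α → ℂ := fun a => ∫ b, F (a, b) ∂ν with hg
  have hgm : Measurable g := (hF.stronglyMeasurable.integral_prod_right').measurable
  have hgK : ∀ a, ‖g a‖ ≤ K := fun a => by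
    have := norm_integral_le_of_norm_le_const (μ := ν) (f := fun b => F (a, b))
      (ae_of_all _ fun b => hK (a, b))
    simpa using this
  have hm : ∫ y, F y ∂μ.prod ν = ∫ a, g a ∂μ := integral_prod _ hFi
  rw [hm]
  set m := ∫ a, g a ∂μ with hm'
  have hmK : ‖m‖ ≤ K := by
    have := norm_integral_le_of_norm_le_const (μ := μ) (f := g) (ae_of_all _ hgK)
    simpa using this
  have hslice : ∀ a, Measurable fun b => F (a, b) := fun a => hF.comp measurable_prodMk_left
  have hi0 : Integrable (fun x => ‖F x - m‖ ^ 2) (μ.prod ν) :=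
    integrable_norm_sub_sq hF measurable_const hK fun _ => hmK
  have hi1 : Integrable (fun x : α × β => ‖F x - g x.1‖ ^ 2) (μ.prod ν) :=
    integrable_norm_sub_sq hF (hgm.comp measurable_fst) hK fun x => hgK x.1
  have hi2 : Integrable (fun x : α × β => ‖F x - F (a₀, x.2)‖ ^ 2) (μ.prod ν) :=
    integrable_norm_sub_sq hF ((hslice a₀).comp measurable_snd) hK fun x => hK _
  have hi3 : Integrable (fun a => ‖g a - m‖ ^ 2) μ :=
    integrable_norm_sub_sq hgm measurable_const hgK fun _ => hmK
  rw [integral_prod _ hi0, integral_prod _ hi2]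
  have h1 : ∀ a, ∫ b, ‖F (a, b) - m‖ ^ 2 ∂ν =
      ∫ b, ‖F (a, b) - g a‖ ^ 2 ∂ν + ‖g a - m‖ ^ 2 := fun a =>
    integral_norm_sub_sq_eq (hslice a) (fun b => hK (a, b)) m
  simp_rw [h1]
  rw [integral_add hi1.integral_prod_left hi3, add_comm]
  refine add_le_add_left ?_ _
  calc ∫ a, ‖g a - m‖ ^ 2 ∂μ ≤ ∫ a, ‖g a - g a₀‖ ^ 2 ∂μ :=
        integral_norm_sub_integral_sq_le hgm hgK _
    _ ≤ ∫ a, ∫ b, ‖F (a, b) - F (a₀, b)‖ ^ 2 ∂ν ∂μ := by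
        refine integral_mono (integrable_norm_sub_sq hgm measurable_const hgK fun _ => hgK a₀)
          hi2.integral_prod_left fun a => ?_
        have hs : ∀ a, Integrable (fun b => F (a, b)) ν := fun a =>
          Integrable.of_bound (hslice a).aestronglyMeasurable K (ae_of_all _ fun b => hK (a, b))
        have : g a - g a₀ = ∫ b, (F (a, b) - F (a₀, b)) ∂ν := (integral_sub (hs a) (hs a₀)).symm
        simp only
        rw [this]
        exact norm_integral_sq_le_integral_norm_sq (K := K + K) ((hslice a).sub (hslice a₀))
          fun b => (norm_sub_le _ _).trans (add_le_add (hK _) (hK _))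

theorem measurable_update_const {ι α : Type*} [DecidableEq ι] [MeasurableSpace α] (i : ι) (c : α) :
    Measurable fun x : ι → α => Function.update x i c := by
  refine measurable_pi_iff.mpr fun j => ?_
  rcases eq_or_ne j i with rfl | h
  · simp
  · simpa [Function.update_of_ne h] using measurable_pi_apply j

/-- The Efron–Stein inequality on a finite product, the modified coordinate being frozen. -/
theorem efronStein_pi_fin {α : Type*} [MeasurableSpace α] (c : α) :
    ∀ (n : ℕ) (μ : Fin n → Measure α) [∀ i, IsProbabilityMeasure (μ i)]
      (F : (Fin n → α) → ℂ) (K : ℝ), Measurable F → (∀ x, ‖F x‖ ≤ K) →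
      ∫ x, ‖F x - ∫ y, F y ∂Measure.pi μ‖ ^ 2 ∂Measure.pi μ ≤
        ∑ i, ∫ x, ‖F x - F (Function.update x i c)‖ ^ 2 ∂Measure.pi μ := by
  intro n
  induction n with
  | zero =>
    intro μ _ F K hF hK
    have h : ∀ x : Fin 0 → α, F x = F ![] := fun x => by rw [Subsingleton.elim x ![]]
    simp_rw [h]
    simp
  | succ n ih =>
    intro μ _ F K hF hK
    set e := MeasurableEquiv.piFinSuccAbove (fun _ : Fin (n + 1) => α) 0 with he
    have hmp := measurePreserving_piFinSuccAbove μ 0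
    rw [← he] at hmp
    set ν := Measure.pi fun j : Fin n => μ (Fin.succAbove 0 j) with hν
    set F' : α × (Fin n → α) → ℂ := fun x => F (e.symm x) with hF'
    have hFF' : ∀ x, F x = F' (e x) := fun x => by simp [hF']
    have hF'm : Measurable F' := hF.comp e.symm.measurable
    have hF'K : ∀ x, ‖F' x‖ ≤ K := fun x => hK _
    have hm : ∫ y, F y ∂Measure.pi μ = ∫ y, F' y ∂(μ 0).prod ν := by
      simp_rw [hFF']
      exact hmp.integral_comp' _
    have hv : ∫ x, ‖F x - ∫ y, F y ∂Measure.pi μ‖ ^ 2 ∂Measure.pi μ =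
        ∫ x, ‖F' x - ∫ y, F' y ∂(μ 0).prod ν‖ ^ 2 ∂(μ 0).prod ν := by
      rw [hm]
      simp_rw [hFF']
      exact hmp.integral_comp' (fun x => ‖F' x - ∫ y, F' y ∂(μ 0).prod ν‖ ^ 2)
    have hsymm : ∀ a b, e.symm (a, b) = Fin.cons a b := fun a b => by
      simp [he, MeasurableEquiv.piFinSuccAbove, Fin.insertNthEquiv]
    have hup0 : ∀ x : Fin (n + 1) → α, F (Function.update x 0 c) = F' (c, (e x).2) := fun x => by
      simp only [hF', hsymm]
      congr 1
      conv_lhs => rw [show x = e.symm ((e x).1, (e x).2) by simp, hsymm]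
      rw [Fin.update_cons_zero]
    have hups : ∀ (x : Fin (n + 1) → α) (i : Fin n), F (Function.update x i.succ c) =
        F' ((e x).1, Function.update (e x).2 i c) := fun x i => by
      simp only [hF', hsymm]
      congr 1
      conv_lhs => rw [show x = e.symm ((e x).1, (e x).2) by simp, hsymm]
      rw [Fin.cons_update]
    rw [hv, Fin.sum_univ_succ]
    have h0 : ∫ x, ‖F x - F (Function.update x 0 c)‖ ^ 2 ∂Measure.pi μ =
        ∫ x, ‖F' x - F' (c, x.2)‖ ^ 2 ∂(μ 0).prod ν := by
      simp_rw [hup0, hFF']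
      exact hmp.integral_comp' (fun x => ‖F' x - F' (c, x.2)‖ ^ 2)
    have hs : ∀ i : Fin n, ∫ x, ‖F x - F (Function.update x i.succ c)‖ ^ 2 ∂Measure.pi μ =
        ∫ x, ‖F' x - F' (x.1, Function.update x.2 i c)‖ ^ 2 ∂(μ 0).prod ν := fun i => by
      simp_rw [hups, hFF']
      exact hmp.integral_comp' (fun x => ‖F' x - F' (x.1, Function.update x.2 i c)‖ ^ 2)
    have hint : ∀ i : Fin n, Integrable
        (fun x : α × (Fin n → α) => ‖F' x - F' (x.1, Function.update x.2 i c)‖ ^ 2)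
        ((μ 0).prod ν) := fun i => by
      refine integrable_norm_sub_sq hF'm (hF'm.comp ?_) hF'K fun x => hF'K _
      exact measurable_fst.prodMk ((measurable_update_const i c).comp measurable_snd)
    refine (variance_prod_le hF'm hF'K c).trans ?_
    rw [h0]
    refine add_le_add_right ?_ _
    simp_rw [hs]
    have hslice : ∀ a, Measurable fun b => F' (a, b) := fun a => hF'm.comp measurable_prodMk_left
    calc _ ≤ ∫ a, ∑ i, ∫ b, ‖F' (a, b) - F' (a, Function.update b i c)‖ ^ 2 ∂ν ∂(μ 0) := by
          refine integral_mono_of_nonneg (ae_of_all _ fun a => integral_nonneg fun _ => sq_nonneg _)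
            (integrable_finsetSum _ fun i _ => (hint i).integral_prod_left)
            (ae_of_all _ fun a => ?_)
          exact ih _ (fun b => F' (a, b)) K (hslice a) fun b => hF'K (a, b)
      _ = _ := by
          rw [integral_finsetSum _ fun i _ => (hint i).integral_prod_left]
          exact Finset.sum_congr rfl fun i _ => (integral_prod _ (hint i)).symm

/-- The Efron–Stein inequality for a bounded function of independent variables. -/
theorem efronStein {Ω ι α : Type*} [MeasurableSpace Ω] [MeasurableSpace α] [Fintype ι]
    [DecidableEq ι] {P : Measure Ω} [IsProbabilityMeasure P] {X : ι → Ω → α}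
    (hX : ∀ i, Measurable (X i)) (hind : iIndepFun X P) (c : α) {F : (ι → α) → ℂ} {K : ℝ}
    (hF : Measurable F) (hK : ∀ x, ‖F x‖ ≤ K) :
    ∫ ω, ‖F (fun i => X i ω) - ∫ ω', F (fun i => X i ω') ∂P‖ ^ 2 ∂P ≤
      ∑ i, ∫ ω, ‖F (fun i => X i ω) - F (Function.update (fun i => X i ω) i c)‖ ^ 2 ∂P := by
  set e := (Fintype.equivFin ι).symm with he
  have hind' : iIndepFun (fun k => X (e k)) P := hind.precomp e.injective
  have hlaw := (iIndepFun_iff_map_fun_eq_pi_map fun k => (hX (e k)).aemeasurable).mp hind'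
  have hXm : Measurable fun ω k => X (e k) ω := measurable_pi_lambda _ fun k => hX (e k)
  have : ∀ k, IsProbabilityMeasure (P.map (X (e k))) := fun k =>
    Measure.isProbabilityMeasure_map (hX (e k)).aemeasurable
  set F' : (Fin (Fintype.card ι) → α) → ℂ := fun x => F (x ∘ e.symm) with hF'
  have hF'm : Measurable F' :=
    hF.comp (measurable_pi_lambda _ fun i => measurable_pi_apply (e.symm i))
  have hFF' : ∀ ω, F (fun i => X i ω) = F' (fun k => X (e k) ω) := fun ω => by
    simp [hF', Function.comp_def]
  have hup : ∀ ω k, F (Function.update (fun i => X i ω) (e k) c) =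
      F' (Function.update (fun k => X (e k) ω) k c) := fun ω k => by
    simp only [hF']
    rw [Function.update_comp_equiv]
    simp [Function.comp_def]
  have h := efronStein_pi_fin c _ (fun k => P.map (X (e k))) F' K hF'm fun x => hK _
  rw [← hlaw] at h
  rw [integral_map hXm.aemeasurable hF'm.aestronglyMeasurable, integral_map hXm.aemeasurable
    (by fun_prop)] at h
  have hs : ∀ k, ∫ x, ‖F' x - F' (Function.update x k c)‖ ^ 2 ∂(P.map fun ω k => X (e k) ω) =
      ∫ ω, ‖F (fun i => X i ω) - F (Function.update (fun i => X i ω) (e k) c)‖ ^ 2 ∂P := by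
    intro k
    rw [integral_map hXm.aemeasurable]
    · simp_rw [hFF', hup]
    · exact ((hF'm.sub (hF'm.comp (measurable_update_const k c))).norm.pow_const 2).aestronglyMeasurable
  simp_rw [hs] at h
  simp_rw [hFF'] at h ⊢
  rw [← Equiv.sum_comp e]
  exact h

/-- A coordinate is independent of the family obtained by freezing it. -/
theorem integral_mul_update_eq {Ω ι : Type*} [MeasurableSpace Ω] [Fintype ι]
    [DecidableEq ι] {P : Measure Ω} [IsProbabilityMeasure P] {X : ι → Ω → ℝ}
    (hX : ∀ i, Measurable (X i)) (hind : iIndepFun X P) (c : ℝ) (i : ι) {ψ : ℝ → ℝ}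
    {Φ : (ι → ℝ) → ℝ} (hψ : Measurable ψ) (hΦ : Measurable Φ) :
    ∫ ω, ψ (X i ω) * Φ (Function.update (fun i => X i ω) i c) ∂P =
      (∫ ω, ψ (X i ω) ∂P) * ∫ ω, Φ (Function.update (fun i => X i ω) i c) ∂P := by
  have h := hind.indepFun_finset {i} (Finset.univ.erase i) (by simp) hX
  set g : (((Finset.univ.erase i : Finset ι) : Type _) → ℝ) → (ι → ℝ) := fun y j =>
    if h : j ∈ Finset.univ.erase i then y ⟨j, h⟩ else c with hg
  have hgm : Measurable g := by
    refine measurable_pi_lambda _ fun j => ?_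
    simp only [hg]
    split_ifs with hj
    · exact measurable_pi_apply _
    · exact measurable_const
  have hgX : ∀ ω, Function.update (fun i => X i ω) i c = g (fun j => X j ω) := fun ω => by
    funext j
    rcases eq_or_ne j i with rfl | hj
    · simp [hg]
    · simp [hg, hj]
  have h2 : IndepFun (fun ω => ψ (X i ω)) (fun ω => Φ (Function.update (fun i => X i ω) i c)) P := by
    have h3 := h.comp (φ := fun y : (({i} : Finset ι) : Type _) → ℝ => ψ (y ⟨i, by simp⟩))
      (ψ := fun y => Φ (g y)) (hψ.comp (measurable_pi_apply _)) (hΦ.comp hgm)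
    simp_rw [hgX]
    exact h3
  refine h2.integral_fun_mul_eq_mul_integral (hψ.comp (hX i)).aestronglyMeasurable ?_
  exact (hΦ.comp ((measurable_update_const i c).comp
    (measurable_pi_lambda _ hX))).aestronglyMeasurable

/-! ### Response of the resolvent to freezing one entry -/

theorem mul_single_mul_apply {n R : Type*} [Fintype n] [DecidableEq n] [CommRing R]
    (A B : Matrix n n R) (k l : n) (c : R) (a b : n) :
    (A * Matrix.single k l c * B) a b = A a k * c * B l b := by
  rw [Matrix.mul_apply, Finset.sum_eq_single l]
  · rw [Matrix.mul_single_apply_same]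
  · intro d _ hd
    rw [Matrix.mul_single_apply_of_ne _ _ _ _ _ hd, zero_mul]
  · simp

section Pointwise

variable {N : ℕ} (z : ℂ) (i j k l : Fin N)

/-- The weight `|G i k|² + |G i l|²` of the resolvent of a symmetric matrix. -/
noncomputable def rowWeight (x : UpperIndex N → ℝ) : ℝ :=
  ‖resolventMatrix (symMatrix x) z i k‖ ^ 2 + ‖resolventMatrix (symMatrix x) z i l‖ ^ 2

/-- The weight `|G i k|² |G l j|² + |G i l|² |G k j|²` of the resolvent of a symmetric matrix. -/
noncomputable def pairWeight (x : UpperIndex N → ℝ) : ℝ :=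
  ‖resolventMatrix (symMatrix x) z i k‖ ^ 2 * ‖resolventMatrix (symMatrix x) z l j‖ ^ 2 +
    ‖resolventMatrix (symMatrix x) z i l‖ ^ 2 * ‖resolventMatrix (symMatrix x) z k j‖ ^ 2

variable {z}

theorem norm_resolventMatrix_symMatrix_apply_le (hz : z.im ≠ 0) (x : UpperIndex N → ℝ) :
    ‖resolventMatrix (symMatrix x) z i j‖ ≤ |z.im|⁻¹ :=
  (norm_apply_le_opNorm _ i j).trans (opNorm_resolventMatrix_le (symMatrix_isSymm x) hz)

theorem continuous_resolventMatrix_symMatrix_apply (hz : z.im ≠ 0) :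
    Continuous fun x : UpperIndex N → ℝ => resolventMatrix (symMatrix x) z i j :=
  (continuous_resolventMatrix_symMatrix hz).matrix_elem i j

theorem continuous_rowWeight (hz : z.im ≠ 0) : Continuous (rowWeight z i k l) :=
  ((continuous_resolventMatrix_symMatrix_apply i k hz).norm.pow 2).add
    ((continuous_resolventMatrix_symMatrix_apply i l hz).norm.pow 2)

theorem continuous_pairWeight (hz : z.im ≠ 0) : Continuous (pairWeight z i j k l) :=
  (((continuous_resolventMatrix_symMatrix_apply i k hz).norm.pow 2).mul
    ((continuous_resolventMatrix_symMatrix_apply l j hz).norm.pow 2)).add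
  (((continuous_resolventMatrix_symMatrix_apply i l hz).norm.pow 2).mul
    ((continuous_resolventMatrix_symMatrix_apply k j hz).norm.pow 2))

theorem rowWeight_nonneg (x : UpperIndex N → ℝ) : 0 ≤ rowWeight z i k l x := by
  unfold rowWeight; positivity

theorem pairWeight_nonneg (x : UpperIndex N → ℝ) : 0 ≤ pairWeight z i j k l x := by
  unfold pairWeight; positivity

theorem rowWeight_le (hz : z.im ≠ 0) (x : UpperIndex N → ℝ) :
    rowWeight z i k l x ≤ 2 * (|z.im|⁻¹) ^ 2 := by
  have h1 := pow_le_pow_left₀ (norm_nonneg _) (norm_resolventMatrix_symMatrix_apply_le i k hz x) 2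
  have h2 := pow_le_pow_left₀ (norm_nonneg _) (norm_resolventMatrix_symMatrix_apply_le i l hz x) 2
  unfold rowWeight
  linarith

theorem pairWeight_le (hz : z.im ≠ 0) (x : UpperIndex N → ℝ) :
    pairWeight z i j k l x ≤ 2 * (|z.im|⁻¹) ^ 4 := by
  have h : ∀ a b, ‖resolventMatrix (symMatrix x) z a b‖ ^ 2 ≤ (|z.im|⁻¹) ^ 2 := fun a b =>
    pow_le_pow_left₀ (norm_nonneg _) (norm_resolventMatrix_symMatrix_apply_le a b hz x) 2
  have h1 := mul_le_mul (h i k) (h l j) (sq_nonneg _) (sq_nonneg _)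
  have h2 := mul_le_mul (h i l) (h k j) (sq_nonneg _) (sq_nonneg _)
  unfold pairWeight
  nlinarith

theorem resolventMatrix_apply_sub_update_offDiag (hz : z.im ≠ 0) (x : UpperIndex N → ℝ)
    {p : UpperIndex N} (hp : p.1.1 ≠ p.1.2) (a b : Fin N) :
    resolventMatrix (symMatrix x) z a b -
        resolventMatrix (symMatrix (Function.update x p 0)) z a b =
      ((1 / Real.sqrt N * x p : ℝ) : ℂ) *
        (resolventMatrix (symMatrix (Function.update x p 0)) z a p.1.1 *
            resolventMatrix (symMatrix x) z p.1.2 b +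
          resolventMatrix (symMatrix (Function.update x p 0)) z a p.1.2 *
            resolventMatrix (symMatrix x) z p.1.1 b) := by
  have hmap : (((1 / Real.sqrt N) • (symMatrix x - symMatrix (Function.update x p 0))).map
      fun y : ℝ => (y : ℂ)) = Matrix.single p.1.1 p.1.2 ((1 / Real.sqrt N * x p : ℝ) : ℂ) +
        Matrix.single p.1.2 p.1.1 ((1 / Real.sqrt N * x p : ℝ) : ℂ) := by
    rw [symMatrix_sub_update, if_neg hp]
    ext a b
    simp only [Matrix.map_apply, Matrix.smul_apply, Matrix.add_apply, Matrix.single_apply,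
      smul_eq_mul]
    split_ifs <;> simp [mul_comm, add_mul]
  rw [← Matrix.sub_apply, resolventMatrix_sub (symMatrix_isSymm x) (symMatrix_isSymm _) hz, hmap,
    Matrix.mul_add, Matrix.add_mul, Matrix.add_apply, mul_single_mul_apply,
    mul_single_mul_apply]
  ring

theorem resolventMatrix_apply_sub_update_diag (hz : z.im ≠ 0) (x : UpperIndex N → ℝ)
    {p : UpperIndex N} (hp : p.1.1 = p.1.2) (a b : Fin N) :
    resolventMatrix (symMatrix x) z a b -
        resolventMatrix (symMatrix (Function.update x p 0)) z a b =
      ((1 / Real.sqrt N * x p : ℝ) : ℂ) *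
        (resolventMatrix (symMatrix (Function.update x p 0)) z a p.1.1 *
            resolventMatrix (symMatrix x) z p.1.1 b) := by
  have hmap : (((1 / Real.sqrt N) • (symMatrix x - symMatrix (Function.update x p 0))).map
      fun y : ℝ => (y : ℂ)) = Matrix.single p.1.1 p.1.1 ((1 / Real.sqrt N * x p : ℝ) : ℂ) := by
    rw [symMatrix_sub_update, if_pos hp]
    ext a b
    simp only [Matrix.map_apply, Matrix.smul_apply, Matrix.single_apply, smul_eq_mul]
    split_ifs <;> simp
  rw [← Matrix.sub_apply, resolventMatrix_sub (symMatrix_isSymm x) (symMatrix_isSymm _) hz, hmap,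
    mul_single_mul_apply]
  ring

theorem abs_one_div_sqrt_mul_sq (N : ℕ) (y : ℝ) : |1 / Real.sqrt N * y| ^ 2 = y ^ 2 / N := by
  rw [sq_abs, mul_pow, div_pow, Real.sq_sqrt (Nat.cast_nonneg N)]
  ring

theorem norm_sub_update_offDiag_le (hz : z.im ≠ 0) (x : UpperIndex N → ℝ)
    {p : UpperIndex N} (hp : p.1.1 ≠ p.1.2) (a b : Fin N) :
    ‖resolventMatrix (symMatrix x) z a b -
        resolventMatrix (symMatrix (Function.update x p 0)) z a b‖ ≤
      |1 / Real.sqrt N * x p| *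
        (‖resolventMatrix (symMatrix (Function.update x p 0)) z a p.1.1‖ *
            ‖resolventMatrix (symMatrix x) z p.1.2 b‖ +
          ‖resolventMatrix (symMatrix (Function.update x p 0)) z a p.1.2‖ *
            ‖resolventMatrix (symMatrix x) z p.1.1 b‖) := by
  rw [resolventMatrix_apply_sub_update_offDiag hz x hp, norm_mul, Complex.norm_real,
    Real.norm_eq_abs]
  refine mul_le_mul_of_nonneg_left ((norm_add_le _ _).trans_eq ?_) (abs_nonneg _)
  rw [norm_mul, norm_mul]

theorem sq_le_two_mul_sq_add {a b c : ℝ} (ha : 0 ≤ a) (h : a ≤ b + c) :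
    a ^ 2 ≤ 2 * b ^ 2 + 2 * c ^ 2 := by
  have := pow_le_pow_left₀ ha h 2
  nlinarith [sq_nonneg (b - c)]

/-- The numerical inequalities behind the first-order expansion of a resolvent. -/
theorem expansion_inequalities {h t d α β α' β' a b a' b' : ℝ} (hd : 0 ≤ d)
    (hα : 0 ≤ α) (hβ : 0 ≤ β) (ha : 0 ≤ a) (hb : 0 ≤ b) (ha' : 0 ≤ a') (hb' : 0 ≤ b')
    (ha't : a' ≤ t) (hb't : b' ≤ t)
    (h1 : α ≤ α' + h * (t * (α + β))) (h2 : β ≤ β' + h * (t * (α + β)))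
    (h3 : a' ≤ a + h * (2 * t ^ 2)) (h4 : b' ≤ b + h * (2 * t ^ 2))
    (h5 : a ≤ a' + h * (2 * t ^ 2)) (h6 : b ≤ b' + h * (2 * t ^ 2))
    (h7 : d ≤ h * (α * b' + β * a')) :
    α ^ 2 + β ^ 2 ≤ 2 * (α' ^ 2 + β' ^ 2) + 8 * h ^ 2 * t ^ 2 * (α ^ 2 + β ^ 2) ∧
    d ^ 2 ≤ 4 * h ^ 2 * (α ^ 2 * b ^ 2 + β ^ 2 * a ^ 2) +
      16 * h ^ 4 * t ^ 4 * (α ^ 2 + β ^ 2) ∧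
    α ^ 2 * b ^ 2 + β ^ 2 * a ^ 2 ≤ 4 * (α' ^ 2 * b' ^ 2 + β' ^ 2 * a' ^ 2) +
      24 * h ^ 2 * t ^ 4 * (α ^ 2 + β ^ 2) := by
  -- Unprimed letters belong to the frozen matrix, primed ones to the full matrix: `α, β` are the
  -- moduli of its entries `(i,k), (i,l)`, and `a, b` those of `(k,j), (l,j)`. Here `h = |x p| /
  -- √N`, `t = |Im z|⁻¹`, and `d` is the change of entry `(i,j)`.
  have e1 := sq_le_two_mul_sq_add hα h1
  have e2 := sq_le_two_mul_sq_add hβ h2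
  have e3 := sq_le_two_mul_sq_add ha' h3
  have e4 := sq_le_two_mul_sq_add hb' h4
  have e5 := sq_le_two_mul_sq_add ha h5
  have e6 := sq_le_two_mul_sq_add hb h6
  have e7 := pow_le_pow_left₀ hd h7 2
  have hs : (α + β) ^ 2 ≤ 2 * (α ^ 2 + β ^ 2) := by nlinarith [sq_nonneg (α - β)]
  have hs' : (h * (t * (α + β))) ^ 2 ≤ 2 * (h ^ 2 * t ^ 2) * (α ^ 2 + β ^ 2) := by
    have := mul_le_mul_of_nonneg_left hs (by positivity : 0 ≤ h ^ 2 * t ^ 2)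
    linear_combination this
  have f1 : α ^ 2 ≤ 2 * α' ^ 2 + 4 * (h ^ 2 * t ^ 2) * (α ^ 2 + β ^ 2) := by linarith
  have f2 : β ^ 2 ≤ 2 * β' ^ 2 + 4 * (h ^ 2 * t ^ 2) * (α ^ 2 + β ^ 2) := by linarith
  have ha2 : a' ^ 2 ≤ t ^ 2 := pow_le_pow_left₀ ha' ha't 2
  have hb2 : b' ^ 2 ≤ t ^ 2 := pow_le_pow_left₀ hb' hb't 2
  refine ⟨by linarith, ?_, ?_⟩
  · have g1 : (h * (α * b' + β * a')) ^ 2 ≤ 2 * h ^ 2 * (α ^ 2 * b' ^ 2 + β ^ 2 * a' ^ 2) := by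
      have : (α * b' + β * a') ^ 2 ≤ 2 * (α ^ 2 * b' ^ 2 + β ^ 2 * a' ^ 2) := by
        nlinarith [sq_nonneg (α * b' - β * a')]
      have := mul_le_mul_of_nonneg_left this (sq_nonneg h)
      linear_combination this
    have g2 := mul_le_mul_of_nonneg_left e4 (sq_nonneg (h * α))
    have g3 := mul_le_mul_of_nonneg_left e3 (sq_nonneg (h * β))
    linear_combination e7 + g1 + 2 * g2 + 2 * g3
  · have g1 := mul_le_mul_of_nonneg_left e6 (sq_nonneg α)
    have g2 := mul_le_mul_of_nonneg_left e5 (sq_nonneg β)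
    have g3 := mul_le_mul_of_nonneg_right f1 (sq_nonneg b')
    have g4 := mul_le_mul_of_nonneg_right f2 (sq_nonneg a')
    have hu : 0 ≤ h ^ 2 * t ^ 2 * (α ^ 2 + β ^ 2) := by positivity
    have g5 := mul_le_mul_of_nonneg_left ha2 hu
    have g6 := mul_le_mul_of_nonneg_left hb2 hu
    linear_combination g1 + g2 + 2 * g3 + 2 * g4 + 8 * g5 + 8 * g6

/-- Every factor `x p` on the right multiplies a weight of the frozen matrix, so that expectations
factor by independence. The first and third bounds return from the frozen to the full matrix; the
second is the influence itself. -/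
theorem expansion_offDiag (hz : z.im ≠ 0) (x : UpperIndex N → ℝ)
    {p : UpperIndex N} (hp : p.1.1 ≠ p.1.2) :
    rowWeight z i p.1.1 p.1.2 (Function.update x p 0) ≤ 2 * rowWeight z i p.1.1 p.1.2 x +
        8 * (x p ^ 2 / N) * (|z.im|⁻¹) ^ 2 *
          rowWeight z i p.1.1 p.1.2 (Function.update x p 0) ∧
    ‖resolventMatrix (symMatrix x) z i j -
        resolventMatrix (symMatrix (Function.update x p 0)) z i j‖ ^ 2 ≤
      4 * (x p ^ 2 / N) * pairWeight z i j p.1.1 p.1.2 (Function.update x p 0) +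
        16 * (x p ^ 2 / N) ^ 2 * (|z.im|⁻¹) ^ 4 *
          rowWeight z i p.1.1 p.1.2 (Function.update x p 0) ∧
    pairWeight z i j p.1.1 p.1.2 (Function.update x p 0) ≤
      4 * pairWeight z i j p.1.1 p.1.2 x +
        24 * (x p ^ 2 / N) * (|z.im|⁻¹) ^ 4 *
          rowWeight z i p.1.1 p.1.2 (Function.update x p 0) := by
  rw [← abs_one_div_sqrt_mul_sq, ← pow_mul]
  set h := |1 / Real.sqrt N * x p|
  set t := |z.im|⁻¹ with ht
  have hh0 : 0 ≤ h := abs_nonneg _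
  have ht0 : 0 ≤ t := by positivity
  have hb := fun (y : UpperIndex N → ℝ) (a b : Fin N) =>
    norm_resolventMatrix_symMatrix_apply_le a b hz y
  have hsub := fun (a b : Fin N) => norm_sub_update_offDiag_le hz x hp a b
  have hrow : ∀ b, ‖resolventMatrix (symMatrix (Function.update x p 0)) z i b‖ ≤
      ‖resolventMatrix (symMatrix x) z i b‖ + h * (t *
        (‖resolventMatrix (symMatrix (Function.update x p 0)) z i p.1.1‖ +
          ‖resolventMatrix (symMatrix (Function.update x p 0)) z i p.1.2‖)) := fun b => by
    refine (norm_le_norm_add_norm_sub _ _).trans (add_le_add_right ?_ _)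
    refine (hsub i b).trans (mul_le_mul_of_nonneg_left ?_ hh0)
    have h1 := mul_le_mul_of_nonneg_left (hb x p.1.2 b)
      (norm_nonneg (resolventMatrix (symMatrix (Function.update x p 0)) z i p.1.1))
    have h2 := mul_le_mul_of_nonneg_left (hb x p.1.1 b)
      (norm_nonneg (resolventMatrix (symMatrix (Function.update x p 0)) z i p.1.2))
    linarith
  have hcol : ∀ a, ‖resolventMatrix (symMatrix x) z a j -
        resolventMatrix (symMatrix (Function.update x p 0)) z a j‖ ≤ h * (2 * t ^ 2) := fun a => by
    refine (hsub a j).trans (mul_le_mul_of_nonneg_left ?_ hh0)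
    have h1 := mul_le_mul (hb (Function.update x p 0) a p.1.1) (hb x p.1.2 j) (norm_nonneg _) ht0
    have h2 := mul_le_mul (hb (Function.update x p 0) a p.1.2) (hb x p.1.1 j) (norm_nonneg _) ht0
    linarith
  exact expansion_inequalities (norm_nonneg _) (norm_nonneg _) (norm_nonneg _) (norm_nonneg _)
    (norm_nonneg _) (norm_nonneg _) (norm_nonneg _) (hb x p.1.1 j) (hb x p.1.2 j)
    (hrow _) (hrow _)
    ((norm_le_norm_add_norm_sub' _ _).trans (add_le_add_right (hcol _) _))
    ((norm_le_norm_add_norm_sub' _ _).trans (add_le_add_right (hcol _) _))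
    ((norm_le_norm_add_norm_sub _ _).trans (add_le_add_right (hcol _) _))
    ((norm_le_norm_add_norm_sub _ _).trans (add_le_add_right (hcol _) _))
    (hsub i j)

/-- A diagonal entry contributes only one product, and summing over the diagonal costs no factor
`N`. The crude bound `|Im z|⁻¹` on the second factor therefore suffices, and no fourth moment of the
entry appears. -/
theorem expansion_diag (hz : z.im ≠ 0) (x : UpperIndex N → ℝ)
    {p : UpperIndex N} (hp : p.1.1 = p.1.2) :
    rowWeight z i p.1.1 p.1.1 (Function.update x p 0) ≤ 2 * rowWeight z i p.1.1 p.1.1 x +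
        8 * (x p ^ 2 / N) * (|z.im|⁻¹) ^ 2 *
          rowWeight z i p.1.1 p.1.1 (Function.update x p 0) ∧
    ‖resolventMatrix (symMatrix x) z i j -
        resolventMatrix (symMatrix (Function.update x p 0)) z i j‖ ^ 2 ≤
      (x p ^ 2 / N) * (|z.im|⁻¹) ^ 2 *
        rowWeight z i p.1.1 p.1.1 (Function.update x p 0) := by
  rw [← abs_one_div_sqrt_mul_sq]
  set h := |1 / Real.sqrt N * x p|
  set t := |z.im|⁻¹ with ht
  have hh0 : 0 ≤ h := abs_nonneg _
  have hsub : ∀ b, ‖resolventMatrix (symMatrix x) z i b -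
      resolventMatrix (symMatrix (Function.update x p 0)) z i b‖ ≤
      h * t * ‖resolventMatrix (symMatrix (Function.update x p 0)) z i p.1.1‖ := fun b => by
    rw [resolventMatrix_apply_sub_update_diag hz x hp, norm_mul, Complex.norm_real,
      Real.norm_eq_abs, norm_mul, mul_assoc]
    refine mul_le_mul_of_nonneg_left ?_ hh0
    rw [mul_comm t]
    exact mul_le_mul_of_nonneg_left (norm_resolventMatrix_symMatrix_apply_le _ b hz x)
      (norm_nonneg _)
  have hrow := sq_le_two_mul_sq_add (norm_nonneg _)
    ((norm_le_norm_add_norm_sub _ _).trans (add_le_add_right (hsub p.1.1) _))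
  have hd := pow_le_pow_left₀ (norm_nonneg _) (hsub j) 2
  unfold rowWeight
  set α := ‖resolventMatrix (symMatrix (Function.update x p 0)) z i p.1.1‖
  have : 0 ≤ h ^ 2 * t ^ 2 * α ^ 2 := by positivity
  constructor <;> nlinarith

end Pointwise

/-! ### Expected influence of one entry and the variance bound -/

theorem integrable_comp_of_bounded {Ω ι : Type*} [MeasurableSpace Ω] {P : Measure Ω}
    [IsFiniteMeasure P] {Φ : (ι → ℝ) → ℝ} {K : ℝ} {Y : Ω → ι → ℝ}
    (hY : Measurable Y) (hΦ : Measurable Φ) (h0 : ∀ x, 0 ≤ Φ x) (hK : ∀ x, Φ x ≤ K) :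
    Integrable (fun ω => Φ (Y ω)) P :=
  Integrable.of_bound (hΦ.comp hY).aestronglyMeasurable K
    (ae_of_all _ fun ω => by rw [Real.norm_eq_abs, abs_of_nonneg (h0 _)]; exact hK _)

theorem integrable_mul_comp_of_bounded {Ω ι : Type*} [MeasurableSpace Ω] {P : Measure Ω}
    {Φ : (ι → ℝ) → ℝ} {K : ℝ} {Y : Ω → ι → ℝ} {g : Ω → ℝ} (hg : Integrable g P)
    (hY : Measurable Y) (hΦ : Measurable Φ) (h0 : ∀ x, 0 ≤ Φ x) (hK : ∀ x, Φ x ≤ K) :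
    Integrable (fun ω => g ω * Φ (Y ω)) P :=
  hg.mul_bdd (c := K) (hΦ.comp hY).aestronglyMeasurable
    (ae_of_all _ fun ω => by rw [Real.norm_eq_abs, abs_of_nonneg (h0 _)]; exact hK _)

section Influence

variable {Ω : Type*} [MeasurableSpace Ω] {P : Measure Ω} [IsProbabilityMeasure P] {N : ℕ}
  {X : UpperIndex N → Ω → ℝ} {z : ℂ} (i j : Fin N)

/-- If a weight of the full matrix controls the same weight of the matrix with a frozen entry up to
a small multiple of the latter, then it does so in expectation. -/
theorem integral_update_le_of_expansion (hX : ∀ p, Measurable (X p)) (hind : iIndepFun X P)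
    {p : UpperIndex N} {s t : ℝ} (h2 : Integrable (fun ω => X p ω ^ 2) P)
    (hs : ∫ ω, X p ω ^ 2 ∂P ≤ s) (hN : 0 < N) (hreg : 16 * s * t ^ 2 ≤ N)
    {Φ : (UpperIndex N → ℝ) → ℝ} {K : ℝ} (hΦ : Measurable Φ) (h0 : ∀ x, 0 ≤ Φ x)
    (hK : ∀ x, Φ x ≤ K)
    (hexp : ∀ x : UpperIndex N → ℝ, Φ (Function.update x p 0) ≤
      2 * Φ x + 8 * (x p ^ 2 / N) * t ^ 2 * Φ (Function.update x p 0)) :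
    ∫ ω, Φ (Function.update (fun q => X q ω) p 0) ∂P ≤ 4 * ∫ ω, Φ (fun q => X q ω) ∂P := by
  have hN' : (0 : ℝ) < N := Nat.cast_pos.mpr hN
  have hXm : Measurable fun ω q => X q ω := measurable_pi_lambda _ hX
  have hUm : Measurable fun ω => Function.update (fun q => X q ω) p 0 :=
    (measurable_update_const p 0).comp hXm
  have hi : Integrable (fun ω => Φ (fun q => X q ω)) P := integrable_comp_of_bounded hXm hΦ h0 hK
  have hi0 : Integrable (fun ω => Φ (Function.update (fun q => X q ω) p 0)) P :=
    integrable_comp_of_bounded hUm hΦ h0 hK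
  have hi2 := integrable_mul_comp_of_bounded h2 hUm hΦ h0 hK
  have hfac := integral_mul_update_eq hX hind 0 p (ψ := fun y => y ^ 2) (Φ := Φ) (by fun_prop) hΦ
  set u₀ := ∫ ω, Φ (Function.update (fun q => X q ω) p 0) ∂P with hu₀
  have hu₀0 : 0 ≤ u₀ := integral_nonneg fun _ => h0 _
  have hle : u₀ ≤ 2 * ∫ ω, Φ (fun q => X q ω) ∂P +
      8 * t ^ 2 / N * ((∫ ω, X p ω ^ 2 ∂P) * u₀) := by
    rw [← hfac, ← integral_const_mul, ← integral_const_mul,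
      ← integral_add (hi.const_mul 2) (hi2.const_mul _)]
    refine integral_mono hi0 ((hi.const_mul 2).add (hi2.const_mul _)) fun ω => ?_
    refine (hexp fun q => X q ω).trans_eq ?_
    ring
  -- The regime `16 s t² ≤ N` makes the coefficient of `u₀` at most `1/2`; absorbing it on the left
  -- turns the factor `2` into `4`.
  have h3 : 8 * t ^ 2 / N * ((∫ ω, X p ω ^ 2 ∂P) * u₀) ≤ u₀ / 2 := by
    have h4 : 8 * t ^ 2 / N * ((∫ ω, X p ω ^ 2 ∂P) * u₀) ≤ 8 * t ^ 2 / N * (s * u₀) := by gcongr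
    refine h4.trans ?_
    have h5 : 8 * t ^ 2 / N * s ≤ 1 / 2 := by
      rw [div_mul_eq_mul_div, div_le_iff₀ hN']
      linarith
    nlinarith
  linarith

theorem integral_influence_diag_le (hz : z.im ≠ 0) (hX : ∀ p, Measurable (X p))
    (hind : iIndepFun X P) {p : UpperIndex N} (hp : p.1.1 = p.1.2) {s : ℝ}
    (h2 : Integrable (fun ω => X p ω ^ 2) P) (hs : ∫ ω, X p ω ^ 2 ∂P ≤ s)
    (hreg : 16 * s * (|z.im|⁻¹) ^ 2 ≤ N) :
    ∫ ω, ‖resolventMatrix (symMatrix fun q => X q ω) z i j -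
        resolventMatrix (symMatrix (Function.update (fun q => X q ω) p 0)) z i j‖ ^ 2 ∂P ≤
      4 * s * (|z.im|⁻¹) ^ 2 / N * ∫ ω, rowWeight z i p.1.1 p.1.1 (fun q => X q ω) ∂P := by
  have hN : 0 < N := i.pos
  have hXm : Measurable fun ω q => X q ω := measurable_pi_lambda _ hX
  have hUm : Measurable fun ω => Function.update (fun q => X q ω) p 0 :=
    (measurable_update_const p 0).comp hXm
  have hm := (continuous_rowWeight i p.1.1 p.1.1 hz).measurable
  have h4 := integral_update_le_of_expansion hX hind h2 hs hN hreg hm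
    (rowWeight_nonneg i p.1.1 p.1.1) (rowWeight_le i p.1.1 p.1.1 hz)
    fun x => (expansion_diag i i hz x hp).1
  have hi2 := integrable_mul_comp_of_bounded h2 hUm hm (rowWeight_nonneg i p.1.1 p.1.1)
    (rowWeight_le i p.1.1 p.1.1 hz)
  have hfac := integral_mul_update_eq hX hind 0 p (ψ := fun y => y ^ 2)
    (Φ := rowWeight z i p.1.1 p.1.1) (by fun_prop) hm
  calc _ ≤ ∫ ω, (|z.im|⁻¹) ^ 2 / N * (X p ω ^ 2 *
        rowWeight z i p.1.1 p.1.1 (Function.update (fun q => X q ω) p 0)) ∂P := by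
        refine integral_mono_of_nonneg (ae_of_all _ fun _ => sq_nonneg _) (hi2.const_mul _)
          (ae_of_all _ fun ω => ?_)
        refine (expansion_diag i j hz (fun q => X q ω) hp).2.trans_eq ?_
        ring
    _ ≤ (|z.im|⁻¹) ^ 2 / N * (s * (4 * ∫ ω, rowWeight z i p.1.1 p.1.1 (fun q => X q ω) ∂P)) := by
        rw [integral_const_mul, hfac]
        have : 0 ≤ ∫ ω, rowWeight z i p.1.1 p.1.1 (Function.update (fun q => X q ω) p 0) ∂P :=
          integral_nonneg fun _ => rowWeight_nonneg _ _ _ _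
        have hs0 : 0 ≤ s := (integral_nonneg fun _ => sq_nonneg _).trans hs
        gcongr
    _ = _ := by ring

/-- The second moment of the entry multiplies the pair weight and the fourth moment multiplies the
row weight. Passing from the frozen pair weight to the full one produces another row-weight term, of
size `s² / N²`; hence the combination `96 s² + 16 κ`. -/
theorem integral_influence_offDiag_le (hz : z.im ≠ 0) (hX : ∀ p, Measurable (X p))
    (hind : iIndepFun X P) {p : UpperIndex N} (hp : p.1.1 ≠ p.1.2) {s κ : ℝ}
    (h2 : Integrable (fun ω => X p ω ^ 2) P) (hs : ∫ ω, X p ω ^ 2 ∂P ≤ s)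
    (h4 : Integrable (fun ω => X p ω ^ 4) P) (hκ : ∫ ω, X p ω ^ 4 ∂P ≤ κ)
    (hreg : 16 * s * (|z.im|⁻¹) ^ 2 ≤ N) :
    ∫ ω, ‖resolventMatrix (symMatrix fun q => X q ω) z i j -
        resolventMatrix (symMatrix (Function.update (fun q => X q ω) p 0)) z i j‖ ^ 2 ∂P ≤
      16 * s / N * ∫ ω, pairWeight z i j p.1.1 p.1.2 (fun q => X q ω) ∂P +
        4 * (96 * s ^ 2 + 16 * κ) * (|z.im|⁻¹) ^ 4 / N ^ 2 *
          ∫ ω, rowWeight z i p.1.1 p.1.2 (fun q => X q ω) ∂P := by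
  have hN : 0 < N := i.pos
  have hN' : (0 : ℝ) < N := Nat.cast_pos.mpr hN
  have hXm : Measurable fun ω q => X q ω := measurable_pi_lambda _ hX
  have hUm : Measurable fun ω => Function.update (fun q => X q ω) p 0 :=
    (measurable_update_const p 0).comp hXm
  have hum := (continuous_rowWeight i p.1.1 p.1.2 hz).measurable
  have hwm := (continuous_pairWeight i j p.1.1 p.1.2 hz).measurable
  have hu0 := rowWeight_nonneg (z := z) i p.1.1 p.1.2
  have hw0 := pairWeight_nonneg (z := z) i j p.1.1 p.1.2
  have huK := rowWeight_le i p.1.1 p.1.2 hz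
  have hwK := pairWeight_le i j p.1.1 p.1.2 hz
  have hexp := fun x => expansion_offDiag i j hz x hp
  have hu := integral_update_le_of_expansion hX hind h2 hs hN hreg hum hu0 huK fun x => (hexp x).1
  have hi2u := integrable_mul_comp_of_bounded h2 hUm hum hu0 huK
  have hi4u := integrable_mul_comp_of_bounded h4 hUm hum hu0 huK
  have hi2w := integrable_mul_comp_of_bounded h2 hUm hwm hw0 hwK
  have hiw : Integrable (fun ω => pairWeight z i j p.1.1 p.1.2 (fun q => X q ω)) P :=
    integrable_comp_of_bounded hXm hwm hw0 hwK
  have hiw' : Integrable (fun ω => pairWeight z i j p.1.1 p.1.2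
      (Function.update (fun q => X q ω) p 0)) P := integrable_comp_of_bounded hUm hwm hw0 hwK
  have f2u := integral_mul_update_eq hX hind 0 p (ψ := fun y => y ^ 2)
    (Φ := rowWeight z i p.1.1 p.1.2) (by fun_prop) hum
  have f4u := integral_mul_update_eq hX hind 0 p (ψ := fun y => y ^ 4)
    (Φ := rowWeight z i p.1.1 p.1.2) (by fun_prop) hum
  have f2w := integral_mul_update_eq hX hind 0 p (ψ := fun y => y ^ 2)
    (Φ := pairWeight z i j p.1.1 p.1.2) (by fun_prop) hwm
  have hs0 : 0 ≤ s := (integral_nonneg fun _ => sq_nonneg _).trans hs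
  have hκ0 : 0 ≤ κ := (integral_nonneg fun _ => by positivity).trans hκ
  set t := |z.im|⁻¹ with ht
  set u₀ := ∫ ω, rowWeight z i p.1.1 p.1.2 (Function.update (fun q => X q ω) p 0) ∂P with hu₀
  set w₀ := ∫ ω, pairWeight z i j p.1.1 p.1.2 (Function.update (fun q => X q ω) p 0) ∂P with hw₀
  set u := ∫ ω, rowWeight z i p.1.1 p.1.2 (fun q => X q ω) ∂P
  set w := ∫ ω, pairWeight z i j p.1.1 p.1.2 (fun q => X q ω) ∂P with hw
  have hu₀0 : 0 ≤ u₀ := integral_nonneg fun _ => hu0 _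
  have hw₀0 : 0 ≤ w₀ := integral_nonneg fun _ => hw0 _
  have hwle : w₀ ≤ 4 * w + 24 * t ^ 4 / N * (s * u₀) := by
    calc w₀ ≤ 4 * w + 24 * t ^ 4 / N * ((∫ ω, X p ω ^ 2 ∂P) * u₀) := by
          rw [← f2u, ← integral_const_mul, ← integral_const_mul,
            ← integral_add (hiw.const_mul 4) (hi2u.const_mul _)]
          refine integral_mono hiw' ((hiw.const_mul 4).add (hi2u.const_mul _)) fun ω => ?_
          refine (hexp fun q => X q ω).2.2.trans_eq ?_
          ring
      _ ≤ _ := by gcongr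
  calc _ ≤ ∫ ω, (4 / N * (X p ω ^ 2 * pairWeight z i j p.1.1 p.1.2
        (Function.update (fun q => X q ω) p 0)) + 16 * t ^ 4 / N ^ 2 * (X p ω ^ 4 *
        rowWeight z i p.1.1 p.1.2 (Function.update (fun q => X q ω) p 0))) ∂P := by
        refine integral_mono_of_nonneg (ae_of_all _ fun _ => sq_nonneg _)
          ((hi2w.const_mul _).add (hi4u.const_mul _)) (ae_of_all _ fun ω => ?_)
        refine (hexp fun q => X q ω).2.1.trans_eq ?_
        ring
    _ = 4 / N * ((∫ ω, X p ω ^ 2 ∂P) * w₀) + 16 * t ^ 4 / N ^ 2 * ((∫ ω, X p ω ^ 4 ∂P) * u₀) := by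
        rw [integral_add (hi2w.const_mul _) (hi4u.const_mul _), integral_const_mul,
          integral_const_mul, f2w, f4u]
    _ ≤ 4 / N * (s * (4 * w + 24 * t ^ 4 / N * (s * (4 * u)))) +
        16 * t ^ 4 / N ^ 2 * (κ * (4 * u)) := by
        have : w₀ ≤ 4 * w + 24 * t ^ 4 / N * (s * (4 * u)) := hwle.trans (by gcongr)
        gcongr
    _ = _ := by
        field_simp
        ring

theorem sum_rowWeight_le (x : UpperIndex N → ℝ) :
    ∑ k, ∑ l, rowWeight z i k l x ≤ 2 * N * opNorm (resolventMatrix (symMatrix x) z) ^ 2 := by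
  have h := sum_norm_sq_row_le_opNorm_sq (symMatrix_isSymm x) z i
  unfold rowWeight
  simp only [Finset.sum_add_distrib, Finset.sum_const, Finset.card_univ, Fintype.card_fin,
    nsmul_eq_mul]
  rw [← Finset.mul_sum]
  have := mul_le_mul_of_nonneg_left h (Nat.cast_nonneg (α := ℝ) N)
  linarith

theorem sum_rowWeight_diag_le (x : UpperIndex N → ℝ) :
    ∑ k, rowWeight z i k k x ≤ 2 * opNorm (resolventMatrix (symMatrix x) z) ^ 2 := by
  have h := sum_norm_sq_row_le_opNorm_sq (symMatrix_isSymm x) z i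
  unfold rowWeight
  simp only [Finset.sum_add_distrib]
  linarith

/-- The double sum factors into a squared row norm times a squared column norm. One is kept as
`‖G‖²`, the other is bounded by `|Im z|⁻²`; in contrast to the row weight, no factor `N` is lost. -/
theorem sum_pairWeight_le (hz : z.im ≠ 0) (x : UpperIndex N → ℝ) :
    ∑ k, ∑ l, pairWeight z i j k l x ≤
      2 * (|z.im|⁻¹) ^ 2 * opNorm (resolventMatrix (symMatrix x) z) ^ 2 := by
  set M := resolventMatrix (symMatrix x) z with hM
  have h1 : ∑ k, ‖M i k‖ ^ 2 ≤ opNorm M ^ 2 := sum_norm_sq_row_le_opNorm_sq (symMatrix_isSymm x) z i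
  have h2 : ∑ l, ‖M l j‖ ^ 2 ≤ (|z.im|⁻¹) ^ 2 := (sum_norm_sq_col_le_opNorm_sq M j).trans
    (pow_le_pow_left₀ (opNorm_nonneg _) (opNorm_resolventMatrix_le (symMatrix_isSymm x) hz) 2)
  have h3 : ∑ k, ∑ l, pairWeight z i j k l x =
      2 * ((∑ k, ‖M i k‖ ^ 2) * ∑ l, ‖M l j‖ ^ 2) := by
    unfold pairWeight
    simp only [Finset.sum_add_distrib, ← hM]
    rw [Finset.sum_mul_sum, two_mul]
    congr 1
    rw [Finset.sum_comm]
  have h4 := mul_le_mul h1 h2 (Finset.sum_nonneg fun _ _ => sq_nonneg _) (sq_nonneg _)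
  rw [h3]
  linarith

/-- The sum over the positions on and above the diagonal is at most the full double sum. -/
theorem sum_upperIndex_le {f : Fin N → Fin N → ℝ} (hf : ∀ k l, 0 ≤ f k l) :
    ∑ p : UpperIndex N, f p.1.1 p.1.2 ≤ ∑ k, ∑ l, f k l := by
  rw [← Fintype.sum_prod_type', ← Finset.sum_subtype (Finset.univ.filter fun p => p.1 ≤ p.2)
    (by simp) (fun p : Fin N × Fin N => f p.1 p.2)]
  exact Finset.sum_le_univ_sum_of_nonneg fun p => hf _ _

/-- The variance bound for the entries of the resolvent of a real symmetric matrix with independent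
centred entries. -/
theorem variance_resolvent_le (hz : z.im ≠ 0) (hX : ∀ p, Measurable (X p))
    (hind : iIndepFun X P) {s κ : ℝ} (hs0 : 0 ≤ s) (hκ0 : 0 ≤ κ)
    (h2 : ∀ p, Integrable (fun ω => X p ω ^ 2) P) (hs : ∀ p, ∫ ω, X p ω ^ 2 ∂P ≤ s)
    (h4 : ∀ p : UpperIndex N, p.1.1 ≠ p.1.2 → Integrable (fun ω => X p ω ^ 4) P)
    (hκ : ∀ p : UpperIndex N, p.1.1 ≠ p.1.2 → ∫ ω, X p ω ^ 4 ∂P ≤ κ) :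
    ∫ ω, ‖resolventMatrix (symMatrix fun q => X q ω) z i j -
        ∫ ω', resolventMatrix (symMatrix fun q => X q ω') z i j ∂P‖ ^ 2 ∂P ≤
      (∫ ω, opNorm (resolventMatrix (symMatrix fun q => X q ω) z) ^ 2 ∂P) *
        (40 * s * (|z.im|⁻¹) ^ 2 + 8 * (96 * s ^ 2 + 16 * κ) * (|z.im|⁻¹) ^ 4) / N := by
  have hN : 0 < N := i.pos
  have hN' : (0 : ℝ) < N := Nat.cast_pos.mpr hN
  have hXm : Measurable fun ω q => X q ω := measurable_pi_lambda _ hX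
  have hFm : Measurable fun x : UpperIndex N → ℝ => resolventMatrix (symMatrix x) z i j :=
    (continuous_resolventMatrix_symMatrix_apply i j hz).measurable
  have hFK := norm_resolventMatrix_symMatrix_apply_le i j hz
  have hQi : Integrable (fun ω => opNorm (resolventMatrix (symMatrix fun q => X q ω) z) ^ 2) P :=
    integrable_comp_of_bounded (Φ := fun x => opNorm (resolventMatrix (symMatrix x) z) ^ 2)
      (K := (|z.im|⁻¹) ^ 2) hXm
      ((continuous_opNorm.comp (continuous_resolventMatrix_symMatrix hz)).pow 2).measurable
      (fun _ => sq_nonneg _)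
      fun x => pow_le_pow_left₀ (opNorm_nonneg _)
        (opNorm_resolventMatrix_le (symMatrix_isSymm x) hz) 2
  set Q := ∫ ω, opNorm (resolventMatrix (symMatrix fun q => X q ω) z) ^ 2 ∂P with hQ
  have hQ0 : 0 ≤ Q := integral_nonneg fun _ => sq_nonneg _
  set t := |z.im|⁻¹ with ht
  -- For small `N` the absorption fails, but then `s t² / N` is bounded below and the trivial bound
  -- of the variance by `E ‖G‖²` is enough.
  rcases lt_or_ge (N : ℝ) (16 * s * t ^ 2) with hreg | hreg
  · calc _ ≤ ∫ ω, ‖resolventMatrix (symMatrix fun q => X q ω) z i j - 0‖ ^ 2 ∂P :=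
          integral_norm_sub_integral_sq_le (hFm.comp hXm) (fun ω => hFK _) 0
      _ ≤ Q := by
          refine integral_mono_of_nonneg (ae_of_all _ fun _ => sq_nonneg _) hQi
            (ae_of_all _ fun ω => ?_)
          simp only [sub_zero]
          exact pow_le_pow_left₀ (norm_nonneg _) (norm_apply_le_opNorm _ i j) 2
      _ ≤ _ := by
          rw [le_div_iff₀ hN']
          refine mul_le_mul_of_nonneg_left ?_ hQ0
          have : 0 ≤ 8 * (96 * s ^ 2 + 16 * κ) * t ^ 4 := by positivity
          have : 0 ≤ s * t ^ 2 := by positivity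
          linarith
  · have huint : ∀ k l, Integrable (fun ω => rowWeight z i k l (fun q => X q ω)) P := fun k l =>
      integrable_comp_of_bounded hXm (continuous_rowWeight i k l hz).measurable
        (rowWeight_nonneg i k l) (rowWeight_le i k l hz)
    have hwint : ∀ k l, Integrable (fun ω => pairWeight z i j k l (fun q => X q ω)) P := fun k l =>
      integrable_comp_of_bounded hXm (continuous_pairWeight i j k l hz).measurable
        (pairWeight_nonneg i j k l) (pairWeight_le i j k l hz)
    set U : Fin N → Fin N → ℝ := fun k l => ∫ ω, rowWeight z i k l (fun q => X q ω) ∂P with hU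
    set V : Fin N → Fin N → ℝ := fun k l => ∫ ω, pairWeight z i j k l (fun q => X q ω) ∂P with hV
    have hU0 : ∀ k l, 0 ≤ U k l := fun k l => integral_nonneg fun _ => rowWeight_nonneg _ _ _ _
    have hV0 : ∀ k l, 0 ≤ V k l := fun k l => integral_nonneg fun _ => pairWeight_nonneg _ _ _ _ _
    have hUs : ∑ k, ∑ l, U k l ≤ 2 * N * Q := by
      simp only [hU, hQ]
      simp_rw [← integral_finsetSum _ fun l _ => huint _ l]
      rw [← integral_finsetSum _ fun k _ => integrable_finsetSum _ fun l _ => huint k l,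
        ← integral_const_mul]
      exact integral_mono
        (integrable_finsetSum _ fun k _ => integrable_finsetSum _ fun l _ => huint k l)
        (hQi.const_mul _) fun ω => sum_rowWeight_le i _
    have hVs : ∑ k, ∑ l, V k l ≤ 2 * t ^ 2 * Q := by
      simp only [hV, hQ]
      simp_rw [← integral_finsetSum _ fun l _ => hwint _ l]
      rw [← integral_finsetSum _ fun k _ => integrable_finsetSum _ fun l _ => hwint k l,
        ← integral_const_mul]
      exact integral_mono
        (integrable_finsetSum _ fun k _ => integrable_finsetSum _ fun l _ => hwint k l)
        (hQi.const_mul _) fun ω => sum_pairWeight_le i j hz _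
    have hDs : ∑ k, U k k ≤ 2 * Q := by
      simp only [hU, hQ]
      rw [← integral_finsetSum _ fun k _ => huint k k, ← integral_const_mul]
      exact integral_mono (integrable_finsetSum _ fun k _ => huint k k)
        (hQi.const_mul _) fun ω => sum_rowWeight_diag_le i _
    -- At diagonal positions the first two terms are mere slack; they are kept so that the sum can
    -- be enlarged to the whole square.
    have hstep : ∀ p : UpperIndex N,
        ∫ ω, ‖resolventMatrix (symMatrix fun q => X q ω) z i j -
          resolventMatrix (symMatrix (Function.update (fun q => X q ω) p 0)) z i j‖ ^ 2 ∂P ≤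
        16 * s / N * V p.1.1 p.1.2 + 4 * (96 * s ^ 2 + 16 * κ) * t ^ 4 / N ^ 2 * U p.1.1 p.1.2 +
          if p.1.1 = p.1.2 then 4 * s * t ^ 2 / N * U p.1.1 p.1.1 else 0 := fun p => by
      have hVp := hV0 p.1.1 p.1.2
      have hUp := hU0 p.1.1 p.1.2
      split_ifs with hp
      · refine (integral_influence_diag_le i j hz hX hind hp (h2 p) (hs p) hreg).trans ?_
        exact le_add_of_nonneg_left (by positivity)
      · rw [add_zero]
        exact integral_influence_offDiag_le i j hz hX hind hp (h2 p) (hs p) (h4 p hp) (hκ p hp) hreg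
    calc _ ≤ _ := efronStein hX hind 0 hFm hFK
      _ ≤ _ := Finset.sum_le_sum fun p _ => hstep p
      _ ≤ _ := sum_upperIndex_le (f := fun k l => 16 * s / N * V k l +
            4 * (96 * s ^ 2 + 16 * κ) * t ^ 4 / N ^ 2 * U k l +
            if k = l then 4 * s * t ^ 2 / N * U k k else 0) fun k l => by
          have hVp := hV0 k l
          have hUp := hU0 k l
          have hUk := hU0 k k
          split_ifs <;> positivity
      _ = 16 * s / N * (∑ k, ∑ l, V k l) +
            4 * (96 * s ^ 2 + 16 * κ) * t ^ 4 / N ^ 2 * (∑ k, ∑ l, U k l) +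
            4 * s * t ^ 2 / N * ∑ k, U k k := by
          simp only [Finset.sum_add_distrib, ← Finset.mul_sum, Finset.sum_ite_eq, Finset.mem_univ,
            if_true]
      _ ≤ 16 * s / N * (2 * t ^ 2 * Q) +
            4 * (96 * s ^ 2 + 16 * κ) * t ^ 4 / N ^ 2 * (2 * N * Q) +
            4 * s * t ^ 2 / N * (2 * Q) := by gcongr
      _ = _ := by
          field_simp
          ring

end Influence

/-! ### Truncation of one variable by a two-point replacement -/

/-- Two coins. -/
abbrev CoinPair : Type u := ULift.{u} (Bool × Bool)

/-- The coins are independent; the first shows `true` with probability `q` (discard), the second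
with probability `θ` (positive sign). -/
theorem exists_coinPair_measure {q θ : ℝ} (hq0 : 0 ≤ q) (hq1 : q ≤ 1) (hθ0 : 0 ≤ θ) (hθ1 : θ ≤ 1) :
    ∃ ν : Measure CoinPair.{u}, IsProbabilityMeasure ν ∧ ∀ g : CoinPair.{u} → ℝ,
      Measurable g ∧ ∫ c, g c ∂ν = (1 - q) * (θ * g ⟨(false, true)⟩ + (1 - θ) * g ⟨(false, false)⟩) +
        q * (θ * g ⟨(true, true)⟩ + (1 - θ) * g ⟨(true, false)⟩) := by
  have hq : 0 ≤ 1 - q := by linarith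
  have hθ : 0 ≤ 1 - θ := by linarith
  have hmeas : ∀ g : CoinPair.{u} → ℝ, Measurable g := fun g => by
    have h : Measurable fun b : Bool × Bool => g ⟨b⟩ := measurable_of_countable _
    exact h.comp measurable_down
  refine ⟨ENNReal.ofReal ((1 - q) * θ) • Measure.dirac ⟨(false, true)⟩ +
    ENNReal.ofReal ((1 - q) * (1 - θ)) • Measure.dirac ⟨(false, false)⟩ +
    (ENNReal.ofReal (q * θ) • Measure.dirac ⟨(true, true)⟩ +
    ENNReal.ofReal (q * (1 - θ)) • Measure.dirac ⟨(true, false)⟩), ⟨?_⟩, fun g => ⟨hmeas g, ?_⟩⟩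
  · simp only [Measure.coe_add, Measure.coe_smul, Pi.add_apply, Pi.smul_apply, measure_univ,
      smul_eq_mul, mul_one]
    rw [← ENNReal.ofReal_add (by positivity) (by positivity),
      ← ENNReal.ofReal_add (by positivity) (by positivity),
      ← ENNReal.ofReal_add (by positivity) (by positivity), ← ENNReal.ofReal_one]
    congr 1
    ring
  · have hsm : StronglyMeasurable g := (hmeas g).stronglyMeasurable
    have hi : ∀ (a : ℝ) (c : CoinPair.{u}), Integrable g (ENNReal.ofReal a • Measure.dirac c) :=
      fun a c => (integrable_dirac' hsm (by simp)).smul_measure ENNReal.ofReal_ne_top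
    rw [integral_add_measure ((hi _ _).add_measure (hi _ _)) ((hi _ _).add_measure (hi _ _)),
      integral_add_measure (hi _ _) (hi _ _), integral_add_measure (hi _ _) (hi _ _)]
    simp only [integral_smul_measure, integral_dirac' _ _ hsm, smul_eq_mul]
    rw [ENNReal.toReal_ofReal (by positivity), ENNReal.toReal_ofReal (by positivity),
      ENNReal.toReal_ofReal (by positivity), ENNReal.toReal_ofReal (by positivity)]
    ring

/-- The two equations say that atoms `± y` of total mass `r` and bias `θ` restore the second and the
first moment. The first fixes `y`, and `q ≤ r` keeps it below `2L`. The second is solvable for `θ`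
in `[0, 1]` exactly when `|(1 - q) δ₁| ≤ r y`, which follows from `δ₁² ≤ (qL)² = q δ₂ ≤ (r y)²`. -/
theorem exists_twoPoint {q r L v δ₁ δ₂ : ℝ} (hq0 : 0 ≤ q) (hq1 : q ≤ 1) (hqr : q ≤ r) (hL : 0 < L)
    (hδ₂ : δ₂ = q * L ^ 2) (hδ₁ : |δ₁| ≤ q * L) (hδv : δ₂ ≤ v) (hv : v ≤ L ^ 2) :
    ∃ y θ : ℝ, 0 ≤ y ∧ y ≤ 2 * L ∧ 0 ≤ θ ∧ θ ≤ 1 ∧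
      r * y ^ 2 = δ₂ + q * (v - δ₂) ∧ r * ((2 * θ - 1) * y) = -((1 - q) * δ₁) := by
  have hr0 : 0 ≤ r := hq0.trans hqr
  rcases hr0.eq_or_lt with hr | hr
  · have hq : q = 0 := le_antisymm (hr ▸ hqr) hq0
    have h1 : δ₁ = 0 := by
      rw [hq, zero_mul] at hδ₁
      exact abs_eq_zero.mp (le_antisymm hδ₁ (abs_nonneg _))
    refine ⟨0, 0, le_rfl, by linarith, le_rfl, zero_le_one, ?_, ?_⟩
    · rw [hδ₂, hq]; ring
    · rw [h1]; ring
  set A := δ₂ + q * (v - δ₂) with hA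
  have hA1 : δ₂ ≤ A := by nlinarith
  have hA0 : 0 ≤ A := le_trans (by rw [hδ₂]; positivity) hA1
  have hA2 : A ≤ 2 * q * L ^ 2 := by nlinarith [mul_nonneg hq0 (by rw [hδ₂]; positivity : 0 ≤ δ₂)]
  set y := Real.sqrt (A / r) with hy
  have hy0 : 0 ≤ y := Real.sqrt_nonneg _
  have hy2 : r * y ^ 2 = A := by
    rw [hy, Real.sq_sqrt (by positivity)]
    field_simp
  have hyL : y ≤ 2 * L := by
    refine le_of_sq_le_sq ?_ (by positivity)
    have : r * y ^ 2 ≤ r * (2 * L) ^ 2 := by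
      rw [hy2]
      nlinarith [sq_nonneg L]
    exact le_of_mul_le_mul_left this hr
  have hkey : |(1 - q) * δ₁| ≤ r * y := by
    refine abs_le_of_sq_le_sq ?_ (by positivity)
    have h1 : δ₁ ^ 2 ≤ (q * L) ^ 2 := sq_le_sq' (abs_le.mp hδ₁).1 (abs_le.mp hδ₁).2
    have h2 : ((1 - q) * δ₁) ^ 2 ≤ δ₁ ^ 2 := by
      rw [mul_pow]
      exact mul_le_of_le_one_left (sq_nonneg _) (by nlinarith)
    have h3 : (q * L) ^ 2 ≤ r * A := by
      calc (q * L) ^ 2 = q * δ₂ := by rw [hδ₂]; ring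
        _ ≤ r * A := mul_le_mul hqr hA1 (by rw [hδ₂]; positivity) hr0
    calc _ ≤ r * A := h2.trans (h1.trans h3)
      _ = (r * y) ^ 2 := by rw [← hy2]; ring
  rcases hy0.eq_or_lt with hy' | hy'
  · have h0 : (1 - q) * δ₁ = 0 := by
      rw [← hy', mul_zero] at hkey
      exact abs_eq_zero.mp (le_antisymm hkey (abs_nonneg _))
    exact ⟨y, 0, hy0, hyL, le_rfl, zero_le_one, hy2, by rw [h0, ← hy']; ring⟩
  · have hry : 0 < r * y := by positivity
    obtain ⟨hk1, hk2⟩ := abs_le.mp hkey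
    refine ⟨y, (1 - (1 - q) * δ₁ / (r * y)) / 2, hy0, hyL, ?_, ?_, hy2, ?_⟩
    · have : (1 - q) * δ₁ / (r * y) ≤ 1 := (div_le_one hry).mpr hk2
      linarith
    · have : -1 ≤ (1 - q) * δ₁ / (r * y) := by rw [le_div_iff₀ hry]; linarith
      linarith
    · field_simp
      ring

/-- Keep `x` if it is small and the first coin shows tails, otherwise replace it by `± y`, the sign
being given by the second coin. -/
noncomputable def replaceLarge (L y : ℝ) (x : ℝ × CoinPair.{u}) : ℝ :=
  if |x.1| ≤ L ∧ x.2.down.1 = false then x.1 else if x.2.down.2 = true then y else -y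

theorem measurable_replaceLarge (L y : ℝ) : Measurable (replaceLarge.{u} L y) := by
  have hd1 : Measurable fun x : ℝ × CoinPair.{u} => x.2.down.1 :=
    measurable_fst.comp (measurable_down.comp measurable_snd)
  have hd2 : Measurable fun x : ℝ × CoinPair.{u} => x.2.down.2 :=
    measurable_snd.comp (measurable_down.comp measurable_snd)
  refine Measurable.ite ?_ measurable_fst (Measurable.ite ?_ measurable_const measurable_const)
  · exact (measurableSet_le measurable_fst.abs measurable_const).inter
      (hd1 (measurableSet_singleton false))
  · exact hd2 (measurableSet_singleton true)

theorem abs_replaceLarge_le {L y : ℝ} (hL : 0 ≤ L) (hy0 : 0 ≤ y) (hy : y ≤ 2 * L)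
    (x : ℝ × CoinPair.{u}) : |replaceLarge L y x| ≤ 2 * L := by
  unfold replaceLarge
  split_ifs with h1 h2
  · linarith [h1.1]
  · rwa [abs_of_nonneg hy0]
  · rwa [abs_neg, abs_of_nonneg hy0]

/-- Truncation of a centred variable at level `2 L`, with exact preservation of the first two
moments and at a cost in probability governed by the tail of the second moment. -/
theorem exists_truncation (μ : Measure ℝ) [IsProbabilityMeasure μ] {L : ℝ} (hL : 0 < L)
    (hμ : MemLp id 2 μ) (hmean : ∫ x, x ∂μ = 0) (hvar : ∫ x, x ^ 2 ∂μ ≤ L ^ 2) :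
    ∃ (ν : Measure CoinPair.{u}) (τ : ℝ × CoinPair.{u} → ℝ), IsProbabilityMeasure ν ∧
      Measurable τ ∧ (∀ x, |τ x| ≤ 2 * L) ∧ ∫ x, τ x ∂μ.prod ν = 0 ∧
      ∫ x, τ x ^ 2 ∂μ.prod ν = ∫ x, x ^ 2 ∂μ ∧
      (MemLp id 4 μ → ∫ x, τ x ^ 4 ∂μ.prod ν ≤ 8 * ∫ x, x ^ 4 ∂μ) ∧
      (μ.prod ν).real {x | τ x ≠ x.1} ≤ 2 * ((∫ x in {x | L < |x|}, x ^ 2 ∂μ) / L ^ 2) := by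
  set S : Set ℝ := {x | |x| ≤ L} with hS
  have hSm : MeasurableSet S := measurableSet_le measurable_id.abs measurable_const
  have hSc : Sᶜ = {x | L < |x|} := by ext x; simp [hS]
  have hi1 : Integrable (fun x : ℝ => x) μ := hμ.integrable (by norm_num)
  have hi2 : Integrable (fun x : ℝ => x ^ 2) μ := hμ.integrable_sq
  set v := ∫ x, x ^ 2 ∂μ with hv
  set δ₁ := ∫ x in S, x ∂μ with hδ₁
  set δ₂ := ∫ x in {x | L < |x|}, x ^ 2 ∂μ with hδ₂
  set q := δ₂ / L ^ 2 with hq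
  have hsum1 : δ₁ + ∫ x in {x | L < |x|}, x ∂μ = 0 := by
    rw [← hSc, ← hmean]; exact integral_add_compl hSm hi1
  have hsum2 : ∫ x in S, x ^ 2 ∂μ + δ₂ = v := by
    rw [hδ₂, ← hSc]; exact integral_add_compl hSm hi2
  have hS20 : 0 ≤ ∫ x in S, x ^ 2 ∂μ := integral_nonneg fun _ => sq_nonneg _
  have hd₀ : 0 ≤ δ₂ := integral_nonneg fun _ => sq_nonneg _
  have hdv : δ₂ ≤ v := by linarith
  have hq0 : 0 ≤ q := by positivity
  have hq1 : q ≤ 1 := by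
    rw [hq, div_le_one (by positivity)]; linarith
  have hdq : δ₂ = q * L ^ 2 := by rw [hq]; field_simp
  have hTm : MeasurableSet {x : ℝ | L < |x|} := hSc ▸ hSm.compl
  have hdq₁ : |δ₁| ≤ q * L := by
    have h1 : δ₁ = -∫ x in {x | L < |x|}, x ∂μ := by linarith
    have h2 : |∫ x in {x | L < |x|}, x ∂μ| ≤ ∫ x in {x | L < |x|}, |x| ∂μ :=
      abs_integral_le_integral_abs
    have h3 : ∫ x in {x | L < |x|}, |x| ∂μ ≤ ∫ x in {x | L < |x|}, L⁻¹ * x ^ 2 ∂μ := by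
      refine setIntegral_mono_on hi1.abs.integrableOn (hi2.const_mul _).integrableOn hTm
        fun x hx => ?_
      have hx' : L < |x| := hx
      rw [← sq_abs, inv_mul_eq_div, le_div_iff₀ hL]
      nlinarith [abs_nonneg x]
    rw [h1, abs_neg]
    refine h2.trans (h3.trans_eq ?_)
    rw [integral_const_mul, ← hδ₂, hdq]
    field_simp
  have hp : 1 - μ.real S ≤ q := by
    have h1 : μ.real {x | L < |x|} = 1 - μ.real S := by
      rw [← hSc, probReal_compl_eq_one_sub hSm]
    rw [← h1, hq, le_div_iff₀ (by positivity)]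
    have h2 : ∫ x in {x : ℝ | L < |x|}, L ^ 2 ∂μ ≤ δ₂ := by
      refine setIntegral_mono_on (integrable_const _).integrableOn hi2.integrableOn hTm
        fun x hx => ?_
      have hx' : L < |x| := hx
      rw [← sq_abs x]
      exact pow_le_pow_left₀ hL.le hx'.le 2
    simpa using h2
  have hS1 : μ.real S ≤ 1 := measureReal_le_one
  -- The probability of being discarded. By Chebyshev, `1 - μ(S) ≤ q`, so `r` lies between `q` and
  -- `2q`.
  set r := 1 - (1 - q) * μ.real S with hr
  have hqr : q ≤ r := by nlinarith
  have hr2 : r ≤ 2 * q := by nlinarith [measureReal_nonneg (μ := μ) (s := S)]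
  obtain ⟨y, θ, hy0, hyL, hθ0, hθ1, hy2, hy1⟩ :=
    exists_twoPoint hq0 hq1 hqr hL hdq hdq₁ hdv hvar
  obtain ⟨ν, hν, hνi⟩ := exists_coinPair_measure.{u} hq0 hq1 hθ0 hθ1
  have hτm := measurable_replaceLarge.{u} L y
  have hτL := abs_replaceLarge_le.{u} hL.le hy0 hyL
  have hint : ∀ n : ℕ, Integrable (fun x : ℝ => x ^ n) (μ.restrict S) →
      ∫ x, replaceLarge L y x ^ n ∂μ.prod ν =
      (1 - q) * ∫ x in S, x ^ n ∂μ + r * (θ * y ^ n + (1 - θ) * (-y) ^ n) := by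
    intro n hn
    have hb : Integrable (fun x => replaceLarge L y x ^ n) (μ.prod ν) := by
      refine Integrable.of_bound (hτm.pow_const n).aestronglyMeasurable ((2 * L) ^ n)
        (ae_of_all _ fun x => ?_)
      rw [norm_pow]
      exact pow_le_pow_left₀ (norm_nonneg _) (hτL x) n
    set A := θ * y ^ n + (1 - θ) * (-y) ^ n with hA
    -- Averaging over the coins with `x` fixed: outside `S` only the atoms contribute, inside `S`
    -- they do so with weight `q`.
    have hinner : ∀ x : ℝ, ∫ c, replaceLarge L y (x, c) ^ n ∂ν =
        A + S.indicator (fun x => (1 - q) * (x ^ n - A)) x := fun x => by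
      rw [(hνi _).2]
      by_cases hx : x ∈ S
      · have hx' : |x| ≤ L := hx
        rw [Set.indicator_of_mem hx]
        simp only [replaceLarge, hx', true_and, if_true, reduceCtorEq, if_false]
        rw [hA]
        ring
      · have hx' : ¬ |x| ≤ L := hx
        rw [Set.indicator_of_notMem hx]
        simp only [replaceLarge, hx', false_and, if_true, reduceCtorEq, if_false]
        rw [hA]
        ring
    rw [integral_prod _ hb]
    simp_rw [hinner]
    have hiS : Integrable (fun x : ℝ => (1 - q) * (x ^ n - A)) (μ.restrict S) :=
      (hn.sub (integrable_const _)).const_mul _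
    rw [integral_add (integrable_const _) ((integrable_indicator_iff hSm).mpr hiS),
      integral_indicator hSm, integral_const_mul, integral_sub hn (integrable_const _)]
    simp only [integral_const, measureReal_restrict_apply_univ, probReal_univ, smul_eq_mul]
    rw [hr]
    ring
  refine ⟨ν, replaceLarge L y, hν, hτm, hτL, ?_, ?_, ?_, ?_⟩
  · have h := hint 1 (by simp only [pow_one]; exact hi1.integrableOn)
    simp only [pow_one] at h
    rw [h, ← hδ₁]
    linear_combination hy1
  · rw [hint 2 hi2.integrableOn]
    linear_combination hy2 + (1 - q) * hsum2
  · intro h4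
    have hi4 : Integrable (fun x : ℝ => x ^ 4) μ := by
      have := h4.integrable_norm_pow (p := 4) (by norm_num)
      simpa [Real.norm_eq_abs, (by decide : Even 4).pow_abs] using this
    rw [hint 4 hi4.integrableOn]
    have hsum4 : ∫ x in S, x ^ 4 ∂μ + ∫ x in {x | L < |x|}, x ^ 4 ∂μ = ∫ x, x ^ 4 ∂μ := by
      rw [← hSc]; exact integral_add_compl hSm hi4
    have hS4 : 0 ≤ ∫ x in S, x ^ 4 ∂μ := integral_nonneg fun _ => by positivity
    have ht4 : L ^ 2 * δ₂ ≤ ∫ x in {x | L < |x|}, x ^ 4 ∂μ := by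
      rw [hδ₂, ← integral_const_mul]
      refine setIntegral_mono_on (hi2.const_mul _).integrableOn hi4.integrableOn hTm
        fun x hx => ?_
      have hx' : L < |x| := hx
      have : L ^ 2 ≤ x ^ 2 := by
        rw [← sq_abs x]
        exact pow_le_pow_left₀ hL.le hx'.le 2
      nlinarith [sq_nonneg x]
    -- The atoms contribute `(r y²) y²`, with `r y² ≤ 2 δ₂` because `q v ≤ q L² = δ₂`, and `y² ≤ 4
    -- L²`.
    have hry : r * (θ * y ^ 4 + (1 - θ) * (-y) ^ 4) ≤ 8 * (L ^ 2 * δ₂) := by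
      have h1 : r * (θ * y ^ 4 + (1 - θ) * (-y) ^ 4) = (r * y ^ 2) * y ^ 2 := by ring
      have h2 : y ^ 2 ≤ 4 * L ^ 2 := by nlinarith
      have h3 : δ₂ + q * (v - δ₂) ≤ 2 * δ₂ := by
        have : q * (v - δ₂) ≤ q * L ^ 2 := mul_le_mul_of_nonneg_left (by linarith) hq0
        linarith
      rw [h1, hy2]
      calc _ ≤ (2 * δ₂) * (4 * L ^ 2) := mul_le_mul h3 h2 (sq_nonneg _) (by positivity)
        _ = _ := by ring
    have : (1 - q) * ∫ x in S, x ^ 4 ∂μ ≤ ∫ x in S, x ^ 4 ∂μ :=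
      mul_le_of_le_one_left hS4 (by linarith)
    linarith
  · refine le_trans ?_ hr2
    have hcm : MeasurableSet {c : CoinPair.{u} | c.down.1 = false} :=
      (measurable_fst.comp measurable_down) (measurableSet_singleton false)
    have hνf : ν.real {c : CoinPair.{u} | c.down.1 = false} = 1 - q := by
      have h1 := (hνi ({c : CoinPair.{u} | c.down.1 = false}.indicator fun _ => (1 : ℝ))).2
      rw [integral_indicator hcm] at h1
      simp [Set.indicator] at h1
      linarith
    have hsub : {x : ℝ × CoinPair.{u} | replaceLarge L y x ≠ x.1} ⊆
        (S ×ˢ {c : CoinPair.{u} | c.down.1 = false})ᶜ := by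
      rintro ⟨x, c⟩ hx ⟨h1, h2⟩
      exact hx (if_pos ⟨h1, h2⟩)
    calc _ ≤ (μ.prod ν).real (S ×ˢ {c : CoinPair.{u} | c.down.1 = false})ᶜ :=
          measureReal_mono hsub
      _ = r := by
          rw [probReal_compl_eq_one_sub (hSm.prod hcm), measureReal_prod_prod, hνf, hr]
          ring

/-! ### Independent coins on an enlarged probability space -/

section Enlargement

variable {Ω ι C : Type*} [MeasurableSpace Ω] [MeasurableSpace C] [Fintype ι]
  {P : Measure Ω} [IsProbabilityMeasure P] {X : ι → Ω → ℝ}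
  {ν : ι → Measure C} [∀ p, IsProbabilityMeasure (ν p)]

/-- The joint law of a variable and of its own fresh source of randomness. -/
theorem map_prodMk_eval_eq (hX : ∀ p, Measurable (X p)) (p : ι) :
    (P.prod (Measure.pi ν)).map (fun ω : Ω × (ι → C) => (X p ω.1, ω.2 p)) =
      (P.map (X p)).prod (ν p) := by
  have h := Measure.map_prod_map P (Measure.pi ν) (hX p) (measurable_pi_apply p)
  rw [(measurePreserving_eval ν p).map_eq] at h
  exact h.symm

/-- Attaching independent randomness to independent variables keeps them independent. -/
theorem iIndepFun_prodMk_eval (hX : ∀ p, Measurable (X p)) (hind : iIndepFun X P) :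
    iIndepFun (fun p (ω : Ω × (ι → C)) => (X p ω.1, ω.2 p)) (P.prod (Measure.pi ν)) := by
  have hm : ∀ p, Measurable fun ω : Ω × (ι → C) => (X p ω.1, ω.2 p) := fun p =>
    ((hX p).comp measurable_fst).prodMk ((measurable_pi_apply p).comp measurable_snd)
  have : ∀ p, IsProbabilityMeasure (P.map (X p)) := fun p =>
    Measure.isProbabilityMeasure_map (hX p).aemeasurable
  rw [iIndepFun_iff_map_fun_eq_pi_map fun p => (hm p).aemeasurable]
  simp_rw [map_prodMk_eval_eq hX]
  have hXm : Measurable fun ω p => X p ω := measurable_pi_lambda _ hX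
  have hlaw := (iIndepFun_iff_map_fun_eq_pi_map fun p => (hX p).aemeasurable).mp hind
  have h1 := Measure.map_prod_map P (Measure.pi ν) hXm measurable_id
  rw [hlaw, Measure.map_id] at h1
  have h2 := (measurePreserving_arrowProdEquivProdArrow ℝ C ι (fun p => P.map (X p)) ν).symm
  rw [← h2.map_eq, h1, Measure.map_map h2.measurable (hXm.prodMap measurable_id)]
  rfl

theorem integral_comp_prodMk_eval (hX : ∀ p, Measurable (X p)) (p : ι) {f : ℝ × C → ℝ}
    (hf : Measurable f) :
    ∫ ω, f (X p ω.1, ω.2 p) ∂P.prod (Measure.pi ν) = ∫ x, f x ∂(P.map (X p)).prod (ν p) := by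
  rw [← map_prodMk_eval_eq hX p, integral_map _ hf.aestronglyMeasurable]
  exact (((hX p).comp measurable_fst).prodMk
    ((measurable_pi_apply p).comp measurable_snd)).aemeasurable

end Enlargement

/-! ### Choice of the truncation levels -/

/-- Diagonal argument: `κ n` is the largest `k ≤ n` whose threshold has been passed by `n`. The
default value `0` of the search is harmless once `n` is past the threshold of `0`. -/
theorem exists_slow_sequence {p : ℕ → ℕ → Prop} (h : ∀ k, ∀ᶠ n in atTop, p k n) :
    ∃ κ : ℕ → ℕ, Tendsto κ atTop atTop ∧ ∀ᶠ n in atTop, p (κ n) n := by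
  classical
  simp_rw [eventually_atTop] at h
  choose n₀ hn₀ using h
  set Q : ℕ → ℕ → Prop := fun k n => n₀ k ≤ n with hQ
  refine ⟨fun n => Nat.findGreatest (fun k => Q k n) n, ?_, ?_⟩
  · refine tendsto_atTop.mpr fun k => ?_
    filter_upwards [eventually_ge_atTop (max k (n₀ k))] with n hn
    exact Nat.le_findGreatest ((le_max_left _ _).trans hn) ((le_max_right _ _).trans hn)
  · filter_upwards [eventually_ge_atTop (n₀ 0)] with n hn
    exact hn₀ _ _ (Nat.findGreatest_spec (P := fun k => Q k n) (Nat.zero_le n) hn)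

theorem rowLindeberg_nonneg {Ω : ℕ → Type u} [∀ N, MeasurableSpace (Ω N)]
    (P : ∀ N, Measure (Ω N)) (W : ∀ N, Ω N → Matrix (Fin N) (Fin N) ℝ) (i : ℕ) (ε : ℝ) (N : ℕ) :
    0 ≤ rowLindeberg P W i ε N := by
  unfold rowLindeberg
  split_ifs
  · exact mul_nonneg (by positivity)
      (Finset.sum_nonneg fun _ _ => integral_nonneg fun _ => by positivity)
  · exact le_rfl

/-- A Lindeberg condition at every fixed level holds along a slowly decreasing sequence. -/
theorem exists_truncation_levels {m : ℕ} {f : ℕ → ℝ → ℕ → ℝ} (hf0 : ∀ i ε N, 0 ≤ f i ε N)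
    (hf : ∀ i < m, ∀ δ > 0, Tendsto (f i δ) atTop (𝓝 0)) :
    ∃ ε : ℕ → ℝ, (∀ N, 0 < ε N) ∧ Tendsto ε atTop (𝓝 0) ∧
      Tendsto (fun N : ℕ => ε N * (N : ℝ) ^ (1 / 4 : ℝ)) atTop atTop ∧
      ∀ i < m, Tendsto (fun N => f i (ε N) N / ε N ^ 4) atTop (𝓝 0) := by
  set e : ℕ → ℝ := fun k => 1 / ((k : ℝ) + 1) with he
  have he0 : ∀ k, 0 < e k := fun k => by positivity
  have het : Tendsto e atTop (𝓝 0) := tendsto_one_div_add_atTop_nhds_zero_nat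
  have hpow : Tendsto (fun N : ℕ => (N : ℝ) ^ (1 / 4 : ℝ)) atTop atTop :=
    (tendsto_rpow_atTop (by norm_num)).comp tendsto_natCast_atTop_atTop
  -- The fifth power leaves a factor `e k` after division by `e k ^ 4`. The first condition forces
  -- `ε N * N^(1/4)` to infinity, which the diagonal entries and the bound `E x² ≤ L²` require.
  have hev : ∀ k : ℕ, ∀ᶠ N : ℕ in atTop, (k : ℝ) ≤ e k * (N : ℝ) ^ (1 / 4 : ℝ) ∧
      ∀ i ∈ Finset.range m, f i (e k) N ≤ e k ^ 5 := fun k => by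
    refine ((hpow.const_mul_atTop (he0 k)).eventually_ge_atTop (k : ℝ)).and ?_
    rw [Filter.eventually_all_finset]
    intro i hi
    exact ((hf i (Finset.mem_range.mp hi) (e k) (he0 k)).eventually_lt_const
      (by have := he0 k; positivity)).mono fun _ h => h.le
  obtain ⟨κ, hκ, hκp⟩ := exists_slow_sequence hev
  refine ⟨fun N => e (κ N), fun N => he0 _, het.comp hκ, ?_, fun i hi => ?_⟩
  · refine tendsto_atTop_mono' _ (hκp.mono fun N h => h.1) ?_
    exact tendsto_natCast_atTop_atTop.comp hκ
  · refine squeeze_zero' (Eventually.of_forall fun N => ?_) (hκp.mono fun N h => ?_) (het.comp hκ)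
    · have := hf0 i (e (κ N)) N
      positivity
    · rw [div_le_iff₀ (by have := he0 (κ N); positivity)]
      refine (h.2 i (Finset.mem_range.mpr hi)).trans_eq ?_
      simp only [Function.comp]
      ring

/-! ### Modification of the entries of a Wigner matrix -/

/-- What is required of the transformation of an entry with law `μ`: it preserves the first two
moments, controls the fourth one, and, if the entry is to be truncated (`b`), bounds it by `2 L`
while changing it with small probability. -/
structure IsEntryModification (μ : Measure ℝ) (L : ℝ) (b : Prop) (ν : Measure CoinPair.{u})
    (τ : ℝ × CoinPair.{u} → ℝ) : Prop where
  prob : IsProbabilityMeasure ν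
  measurable : Measurable τ
  mean : ∫ x, τ x ∂μ.prod ν = 0
  second : ∫ x, τ x ^ 2 ∂μ.prod ν = ∫ x, x ^ 2 ∂μ
  memLp_two : MemLp τ 2 (μ.prod ν)
  memLp_four : MemLp id 4 μ → MemLp τ 4 (μ.prod ν)
  fourth : MemLp id 4 μ → ∫ x, τ x ^ 4 ∂μ.prod ν ≤ 8 * ∫ x, x ^ 4 ∂μ
  abs_le : b → ∀ x, |τ x| ≤ 2 * L
  prob_ne : b →
    (μ.prod ν).real {x | τ x ≠ x.1} ≤ 2 * ((∫ x in {x | L < |x|}, x ^ 2 ∂μ) / L ^ 2)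
  eq_fst : ¬ b → τ = Prod.fst

theorem exists_isEntryModification (μ : Measure ℝ) [IsProbabilityMeasure μ] {L : ℝ} (hL : 0 < L)
    (hμ : MemLp id 2 μ) (hmean : ∫ x, x ∂μ = 0) (hvar : ∫ x, x ^ 2 ∂μ ≤ L ^ 2) (b : Prop) :
    ∃ (ν : Measure CoinPair.{u}) (τ : ℝ × CoinPair.{u} → ℝ), IsEntryModification μ L b ν τ := by
  by_cases hb : b
  · obtain ⟨ν, τ, hν, hτ, h1, h2, h3, h4, h5⟩ := exists_truncation.{u} μ hL hμ hmean hvar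
    have hmem : ∀ p, MemLp τ p (μ.prod ν) := fun p =>
      MemLp.of_bound hτ.aestronglyMeasurable (2 * L) (ae_of_all _ h1)
    exact ⟨ν, τ, hν, hτ, h2, h3, hmem 2, fun _ => hmem 4, h4, fun _ => h1, fun _ => h5,
      fun h => absurd hb h⟩
  · set ν : Measure CoinPair.{u} := Measure.dirac ⟨(false, false)⟩ with hν
    have hmp : MeasurePreserving (Prod.fst : ℝ × CoinPair.{u} → ℝ) (μ.prod ν) μ :=
      measurePreserving_fst
    have hint : ∀ n : ℕ, ∫ x : ℝ × CoinPair.{u}, x.1 ^ n ∂μ.prod ν = ∫ x, x ^ n ∂μ := fun n => by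
      conv_rhs => rw [← hmp.map_eq]
      rw [integral_map measurable_fst.aemeasurable (by fun_prop)]
    refine ⟨ν, Prod.fst, inferInstance, measurable_fst, ?_, hint 2, hμ.comp_measurePreserving hmp,
      fun h => h.comp_measurePreserving hmp, fun _ => ?_, fun h => absurd h hb,
      fun h => absurd h hb, fun _ => rfl⟩
    · simpa [hmean] using hint 1
    · rw [hint 4]
      have : 0 ≤ ∫ x, x ^ 4 ∂μ := integral_nonneg fun _ => by positivity
      linarith

theorem exists_upperIndex {N : ℕ} (j k : Fin N) : ∃ p : UpperIndex N,
    (∀ x : UpperIndex N → ℝ, symMatrix x j k = x p) ∧ (p.1 = (j, k) ∨ p.1 = (k, j)) := by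
  by_cases h : j ≤ k
  · exact ⟨⟨(j, k), h⟩, fun x => by simp [symMatrix, h], Or.inl rfl⟩
  · exact ⟨⟨(k, j), (not_le.mp h).le⟩, fun x => by simp [symMatrix, h], Or.inr rfl⟩

/-- Apply to each entry of a symmetric matrix a function of the entry and of a pair of coins. -/
def modifyEntries {N : ℕ} (A : Matrix (Fin N) (Fin N) ℝ)
    (τ : UpperIndex N → ℝ × CoinPair.{u} → ℝ) (c : UpperIndex N → CoinPair.{u}) :
    Matrix (Fin N) (Fin N) ℝ :=
  symMatrix fun p => τ p (A p.1.1 p.1.2, c p)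

namespace IsWigner

variable {Ω : ℕ → Type u} [∀ N, MeasurableSpace (Ω N)] {P : ∀ N, Measure (Ω N)}
  {W : ∀ N, Ω N → Matrix (Fin N) (Fin N) ℝ} {σ σ₁ m₄ : ℝ}

theorem integral_offDiag_sq [∀ N, IsProbabilityMeasure (P N)] (hW : IsWigner P W σ σ₁ m₄)
    (N : ℕ) {j k : Fin N} (h : j ≠ k) : ∫ ω, W N ω j k ^ 2 ∂(P N) = σ ^ 2 := by
  rw [← hW.offDiag_variance N j k h,
    variance_of_integral_eq_zero (hW.measurable_entry N j k).aemeasurable (hW.offDiag_mean N j k h)]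

theorem memLp_two [∀ N, IsProbabilityMeasure (P N)] (hW : IsWigner P W σ σ₁ m₄)
    (N : ℕ) (j k : Fin N) : MemLp (fun ω => W N ω j k) 2 (P N) := by
  by_cases h : j = k
  · subst h; exact hW.diag_memLp N j
  · exact (hW.offDiag_memLp N j k h).mono_exponent (by norm_num)

theorem mean_eq_zero (hW : IsWigner P W σ σ₁ m₄) (N : ℕ) (j k : Fin N) :
    ∫ ω, W N ω j k ∂(P N) = 0 := by
  by_cases h : j = k
  · subst h; exact hW.diag_mean N j
  · exact hW.offDiag_mean N j k h

theorem integral_sq_le [∀ N, IsProbabilityMeasure (P N)] (hW : IsWigner P W σ σ₁ m₄)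
    (N : ℕ) (j k : Fin N) : ∫ ω, W N ω j k ^ 2 ∂(P N) ≤ σ ^ 2 + σ₁ ^ 2 := by
  by_cases h : j = k
  · subst h; exact (hW.diag_second N j).trans (le_add_of_nonneg_left (sq_nonneg _))
  · rw [hW.integral_offDiag_sq N h]; exact le_add_of_nonneg_right (sq_nonneg _)

/-- The variance bound for the entries of the resolvent of a Wigner matrix. -/
theorem cVariance_resolvent_le [∀ N, IsProbabilityMeasure (P N)] (hW : IsWigner P W σ σ₁ m₄)
    {N : ℕ} (i j : Fin N) {z : ℂ} (hz : z.im ≠ 0) :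
    cVariance (P N) (fun ω => resolventMatrix (W N ω) z i j) ≤
      (∫ ω, opNorm (resolventMatrix (W N ω) z) ^ 2 ∂(P N)) *
        (40 * (σ ^ 2 + σ₁ ^ 2) * (|z.im|⁻¹) ^ 2 +
          8 * (96 * (σ ^ 2 + σ₁ ^ 2) ^ 2 + 16 * |m₄|) * (|z.im|⁻¹) ^ 4) / N := by
  have hsym : ∀ ω, symMatrix (fun q : UpperIndex N => W N ω q.1.1 q.1.2) = W N ω := fun ω =>
    symMatrix_of_isSymm (hW.isSymm N ω)
  have h := variance_resolvent_le (P := P N) (X := fun (p : UpperIndex N) ω => W N ω p.1.1 p.1.2)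
    i j hz (fun p => hW.measurable_entry N _ _) (hW.indep N)
    (s := σ ^ 2 + σ₁ ^ 2) (κ := |m₄|) (by positivity) (abs_nonneg _)
    (fun p => (hW.memLp_two N _ _).integrable_sq) (fun p => hW.integral_sq_le N _ _)
    (fun p hp => by
      have := (hW.offDiag_memLp N _ _ hp).integrable_norm_pow (p := 4) (by norm_num)
      simpa [Real.norm_eq_abs, (by decide : Even 4).pow_abs] using this)
    (fun p hp => (hW.offDiag_fourth N _ _ hp).trans (le_abs_self _))
  simp only [hsym] at h
  exact h

section Modification

variable [∀ N, IsProbabilityMeasure (P N)] {L : ℕ → ℝ} {b : ∀ N, UpperIndex N → Prop}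
  {ν : ∀ N, UpperIndex N → Measure CoinPair.{u}} {τ : ∀ N, UpperIndex N → ℝ × CoinPair.{u} → ℝ}

/-- Each new entry is a function of the old one and of its own coins, so independence survives and
every moment is computed under the law of a single entry. -/
theorem modifyEntries (hW : IsWigner P W σ σ₁ m₄)
    (hmod : ∀ N p, IsEntryModification ((P N).map fun ω => W N ω p.1.1 p.1.2) (L N) (b N p)
      (ν N p) (τ N p)) :
    IsWigner (Ω := fun N => Ω N × (UpperIndex N → CoinPair.{u}))
      (fun N => (P N).prod (Measure.pi (ν N)))
      (fun N ω => WignerResolvent.modifyEntries (W N ω.1) (τ N) ω.2) σ σ₁ (8 * m₄) := by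
  have hν : ∀ N p, IsProbabilityMeasure (ν N p) := fun N p => (hmod N p).prob
  have hXm : ∀ N (p : UpperIndex N), Measurable fun ω => W N ω p.1.1 p.1.2 := fun N p =>
    hW.measurable_entry N _ _
  have hpair : ∀ N (p : UpperIndex N), Measurable
      fun ω : Ω N × (UpperIndex N → CoinPair.{u}) => (W N ω.1 p.1.1 p.1.2, ω.2 p) := fun N p =>
    ((hXm N p).comp measurable_fst).prodMk ((measurable_pi_apply p).comp measurable_snd)
  have hmp : ∀ N (p : UpperIndex N), MeasurePreserving
      (fun ω : Ω N × (UpperIndex N → CoinPair.{u}) => (W N ω.1 p.1.1 p.1.2, ω.2 p))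
      ((P N).prod (Measure.pi (ν N)))
      (((P N).map fun ω => W N ω p.1.1 p.1.2).prod (ν N p)) := fun N p =>
    ⟨hpair N p, map_prodMk_eval_eq (hXm N) p⟩
  have hint : ∀ N (p : UpperIndex N) (n : ℕ),
      ∫ ω, τ N p (W N ω.1 p.1.1 p.1.2, ω.2 p) ^ n ∂(P N).prod (Measure.pi (ν N)) =
        ∫ x, τ N p x ^ n ∂((P N).map fun ω => W N ω p.1.1 p.1.2).prod (ν N p) := fun N p n =>
    integral_comp_prodMk_eval (hXm N) p ((hmod N p).measurable.pow_const n)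
  have hmem4 : ∀ N (p : UpperIndex N), p.1.1 ≠ p.1.2 →
      MemLp id 4 ((P N).map fun ω => W N ω p.1.1 p.1.2) := fun N p hp =>
    (memLp_map_measure_iff aestronglyMeasurable_id (hXm N p).aemeasurable).mpr
      (hW.offDiag_memLp N _ _ hp)
  have hmom : ∀ N (p : UpperIndex N) (n : ℕ),
      ∫ x, x ^ n ∂((P N).map fun ω => W N ω p.1.1 p.1.2) =
        ∫ ω, W N ω p.1.1 p.1.2 ^ n ∂(P N) := fun N p n =>
    integral_map (hXm N p).aemeasurable (by fun_prop)
  have hmean : ∀ N (j k : Fin N),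
      ∫ ω, WignerResolvent.modifyEntries (W N ω.1) (τ N) ω.2 j k
        ∂(P N).prod (Measure.pi (ν N)) = 0 := fun N j k => by
    obtain ⟨p, hp, -⟩ := exists_upperIndex j k
    simp only [WignerResolvent.modifyEntries, hp]
    have := hint N p 1
    simp only [pow_one] at this
    rw [this, (hmod N p).mean]
  have hsq : ∀ N (j k : Fin N),
      ∫ ω, WignerResolvent.modifyEntries (W N ω.1) (τ N) ω.2 j k ^ 2
        ∂(P N).prod (Measure.pi (ν N)) = ∫ ω, W N ω j k ^ 2 ∂(P N) := fun N j k => by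
    obtain ⟨p, hp, hp'⟩ := exists_upperIndex j k
    simp only [WignerResolvent.modifyEntries, hp]
    rw [hint N p 2, (hmod N p).second, hmom]
    rcases hp' with hp' | hp'
    · rw [hp']
    · rw [hp']; simp_rw [(hW.isSymm N _).apply j k]
  have hmeas : ∀ N (j k : Fin N), Measurable fun ω : Ω N × (UpperIndex N → CoinPair.{u}) =>
      WignerResolvent.modifyEntries (W N ω.1) (τ N) ω.2 j k := fun N j k => by
    obtain ⟨p, hp, -⟩ := exists_upperIndex j k
    simp only [WignerResolvent.modifyEntries, hp]
    exact (hmod N p).measurable.comp (hpair N p)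
  refine ⟨hmeas, fun N ω => symMatrix_isSymm _, fun N => ?_, fun N j k hjk => ?_,
    fun N j k _ => hmean N j k, fun N j k hjk => ?_, fun N j k hjk => ?_, fun N j => ?_,
    fun N j => hmean N j j, fun N j => ?_⟩
  · have h := (iIndepFun_prodMk_eval (ν := ν N) (hXm N) (hW.indep N)).comp (fun p => τ N p)
      fun p => (hmod N p).measurable
    convert h using 2 with p
    funext ω
    have := p.2
    simp [WignerResolvent.modifyEntries, symMatrix, this]
  · obtain ⟨p, hp, hp'⟩ := exists_upperIndex j k
    have hpne : p.1.1 ≠ p.1.2 := by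
      rcases hp' with hp' | hp'
      · rw [hp']; exact hjk
      · rw [hp']; exact hjk.symm
    simp only [WignerResolvent.modifyEntries, hp]
    exact ((hmod N p).memLp_four (hmem4 N p hpne)).comp_measurePreserving (hmp N p)
  · rw [variance_of_integral_eq_zero (hmeas N j k).aemeasurable (hmean N j k), hsq,
      hW.integral_offDiag_sq N hjk]
  · obtain ⟨p, hp, hp'⟩ := exists_upperIndex j k
    have hpne : p.1.1 ≠ p.1.2 := by
      rcases hp' with hp' | hp'
      · rw [hp']; exact hjk
      · rw [hp']; exact hjk.symm
    simp only [WignerResolvent.modifyEntries, hp]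
    rw [hint N p 4]
    refine ((hmod N p).fourth (hmem4 N p hpne)).trans ?_
    rw [hmom]
    exact mul_le_mul_of_nonneg_left (hW.offDiag_fourth N _ _ hpne) (by norm_num)
  · obtain ⟨p, hp, -⟩ := exists_upperIndex j j
    simp only [WignerResolvent.modifyEntries, hp]
    exact (hmod N p).memLp_two.comp_measurePreserving (hmp N p)
  · rw [hsq]
    exact hW.diag_second N j

/-- On `|x| > L` one has `L² x² ≤ x⁴`, which turns the second-moment tail into the Lindeberg
quantity over `L⁴`. A diagonal entry has only a second moment and yields the weaker `L⁻²`,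
affordable since each row contains just one. -/
theorem prob_modified_ne_le (hW : IsWigner P W σ σ₁ m₄)
    {N : ℕ} (hL : 0 < L N) {p : UpperIndex N} (hb : b N p)
    (hmod : ∀ p, IsEntryModification ((P N).map fun ω => W N ω p.1.1 p.1.2) (L N) (b N p)
      (ν N p) (τ N p)) :
    ((P N).prod (Measure.pi (ν N))).real
        {ω | τ N p (W N ω.1 p.1.1 p.1.2, ω.2 p) ≠ W N ω.1 p.1.1 p.1.2} ≤
      if p.1.1 = p.1.2 then 2 * (σ₁ ^ 2 / L N ^ 2) else
        2 * ((∫ ω in {ω | L N ≤ |W N ω p.1.1 p.1.2|}, |W N ω p.1.1 p.1.2| ^ 4 ∂(P N)) /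
          L N ^ 4) := by
  have hν : ∀ p, IsProbabilityMeasure (ν N p) := fun p => (hmod p).prob
  have hXm : ∀ (p : UpperIndex N), Measurable fun ω => W N ω p.1.1 p.1.2 := fun p =>
    hW.measurable_entry N _ _
  have hset : MeasurableSet {x : ℝ × CoinPair.{u} | τ N p x ≠ x.1} :=
    (measurableSet_eq_fun (hmod p).measurable measurable_fst).compl
  have hpair : Measurable
      fun ω : Ω N × (UpperIndex N → CoinPair.{u}) => (W N ω.1 p.1.1 p.1.2, ω.2 p) :=
    ((hXm p).comp measurable_fst).prodMk ((measurable_pi_apply p).comp measurable_snd)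
  have h1 : ((P N).prod (Measure.pi (ν N))).real
        {ω | τ N p (W N ω.1 p.1.1 p.1.2, ω.2 p) ≠ W N ω.1 p.1.1 p.1.2} =
      (((P N).map fun ω => W N ω p.1.1 p.1.2).prod (ν N p)).real {x | τ N p x ≠ x.1} := by
    rw [← map_prodMk_eval_eq hXm p, map_measureReal_apply hpair hset]
    rfl
  have hTm : MeasurableSet {x : ℝ | L N < |x|} :=
    measurableSet_lt measurable_const measurable_id.abs
  have h2 : ∫ x in {x | L N < |x|}, x ^ 2 ∂((P N).map fun ω => W N ω p.1.1 p.1.2) =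
      ∫ ω in {ω | L N < |W N ω p.1.1 p.1.2|}, W N ω p.1.1 p.1.2 ^ 2 ∂(P N) :=
    setIntegral_map hTm (by fun_prop) (hXm p).aemeasurable
  have hi2 := (hW.memLp_two N p.1.1 p.1.2).integrable_sq
  rw [h1]
  refine ((hmod p).prob_ne hb).trans ?_
  rw [h2]
  split_ifs with hp
  · have h3 : ∫ ω in {ω | L N < |W N ω p.1.1 p.1.2|}, W N ω p.1.1 p.1.2 ^ 2 ∂(P N) ≤ σ₁ ^ 2 := by
      refine (setIntegral_le_integral hi2 (ae_of_all _ fun _ => sq_nonneg _)).trans ?_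
      rw [← hp]
      exact hW.diag_second N _
    gcongr
  · have hi4 : Integrable (fun ω => |W N ω p.1.1 p.1.2| ^ 4) (P N) :=
      (hW.offDiag_memLp N _ _ hp).integrable_norm_pow (p := 4) (by norm_num)
    have hm1 : MeasurableSet {ω | L N < |W N ω p.1.1 p.1.2|} := hXm p hTm
    have h3 : L N ^ 2 * ∫ ω in {ω | L N < |W N ω p.1.1 p.1.2|}, W N ω p.1.1 p.1.2 ^ 2 ∂(P N) ≤
        ∫ ω in {ω | L N ≤ |W N ω p.1.1 p.1.2|}, |W N ω p.1.1 p.1.2| ^ 4 ∂(P N) := by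
      rw [← integral_const_mul]
      calc _ ≤ ∫ ω in {ω | L N < |W N ω p.1.1 p.1.2|}, |W N ω p.1.1 p.1.2| ^ 4 ∂(P N) := by
            refine setIntegral_mono_on (hi2.const_mul _).integrableOn hi4.integrableOn hm1
              fun ω hω => ?_
            have hω' : L N < |W N ω p.1.1 p.1.2| := hω
            have := pow_le_pow_left₀ hL.le hω'.le 2
            rw [← sq_abs (W N ω p.1.1 p.1.2)]
            nlinarith [sq_nonneg |W N ω p.1.1 p.1.2|]
        _ ≤ _ := setIntegral_mono_set hi4.integrableOn (ae_of_all _ fun _ => by positivity)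
            (Eventually.of_forall fun ω hω => le_of_lt hω)
    have h4 : (∫ ω in {ω | L N < |W N ω p.1.1 p.1.2|}, W N ω p.1.1 p.1.2 ^ 2 ∂(P N)) / L N ^ 2 ≤
        (∫ ω in {ω | L N ≤ |W N ω p.1.1 p.1.2|}, |W N ω p.1.1 p.1.2| ^ 4 ∂(P N)) / L N ^ 4 := by
      rw [div_le_div_iff₀ (by positivity) (by positivity)]
      calc _ = (L N ^ 2 * ∫ ω in {ω | L N < |W N ω p.1.1 p.1.2|},
            W N ω p.1.1 p.1.2 ^ 2 ∂(P N)) * L N ^ 2 := by ring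
        _ ≤ _ := mul_le_mul_of_nonneg_right h3 (sq_nonneg _)
    linarith

/-- Union bound over the positions whose smaller index is below `m`; by symmetry these are all the
positions meeting the first `m` rows. Since `L⁴ = ε⁴ N`, the off-diagonal sum of a row is its
Lindeberg functional divided by `ε⁴`. -/
theorem prob_exists_modified_ne_le (hW : IsWigner P W σ σ₁ m₄) {m N : ℕ} {ε : ℝ} (hε : 0 < ε)
    (hN : 0 < N) (hLε : L N = ε * (N : ℝ) ^ (1 / 4 : ℝ))
    (hmod : ∀ p : UpperIndex N, IsEntryModification ((P N).map fun ω => W N ω p.1.1 p.1.2) (L N)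
      ((p.1.1 : ℕ) < m) (ν N p) (τ N p)) :
    ((P N).prod (Measure.pi (ν N))).real {ω | ∀ i k : Fin N, (i : ℕ) < m →
        WignerResolvent.modifyEntries (W N ω.1) (τ N) ω.2 i k = W N ω.1 i k}ᶜ ≤
      ∑ i ∈ Finset.range m, (2 * (σ₁ ^ 2 / L N ^ 2) + 2 * (rowLindeberg P W i ε N / ε ^ 4)) := by
  have hν : ∀ p, IsProbabilityMeasure (ν N p) := fun p => (hmod p).prob
  have hN' : (0 : ℝ) < N := Nat.cast_pos.mpr hN
  have hL : 0 < L N := by rw [hLε]; positivity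
  have hL4 : L N ^ 4 = ε ^ 4 * N := by
    rw [hLε, mul_pow, ← Real.rpow_natCast, ← Real.rpow_natCast, ← Real.rpow_mul hN'.le]
    norm_num
  set J : Fin N → Fin N → ℝ := fun k l =>
    ∫ ω in {ω | L N ≤ |W N ω k l|}, |W N ω k l| ^ 4 ∂(P N) with hJ
  have hJ0 : ∀ k l, 0 ≤ J k l := fun k l => integral_nonneg fun _ => by positivity
  set g : Fin N → Fin N → ℝ := fun k l => if (k : ℕ) < m then
    (if k = l then 2 * (σ₁ ^ 2 / L N ^ 2) else 2 * (J k l / L N ^ 4)) else 0 with hg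
  have hg0 : ∀ k l, 0 ≤ g k l := fun k l => by
    have := hJ0 k l
    simp only [hg]
    split_ifs <;> positivity
  set F : ℕ → ℝ := fun i => 2 * (σ₁ ^ 2 / L N ^ 2) + 2 * (rowLindeberg P W i ε N / ε ^ 4) with hF
  have hF0 : ∀ i, 0 ≤ F i := fun i => by
    have := rowLindeberg_nonneg P W i ε N
    positivity
  set B : UpperIndex N → Set (Ω N × (UpperIndex N → CoinPair.{u})) := fun p =>
    {ω | (p.1.1 : ℕ) < m ∧ τ N p (W N ω.1 p.1.1 p.1.2, ω.2 p) ≠ W N ω.1 p.1.1 p.1.2} with hB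
  have hsub : {ω : Ω N × (UpperIndex N → CoinPair.{u}) | ∀ i k : Fin N, (i : ℕ) < m →
      WignerResolvent.modifyEntries (W N ω.1) (τ N) ω.2 i k = W N ω.1 i k}ᶜ ⊆ ⋃ p, B p := by
    intro ω hω
    simp only [Set.mem_compl_iff, Set.mem_ofPred_eq, not_forall] at hω
    obtain ⟨i, k, him, hne⟩ := hω
    refine Set.mem_iUnion.mpr ?_
    by_cases hik : i ≤ k
    · refine ⟨⟨(i, k), hik⟩, him, fun h => hne ?_⟩
      simpa [WignerResolvent.modifyEntries, symMatrix, hik] using h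
    · have hki : k ≤ i := (not_le.mp hik).le
      refine ⟨⟨(k, i), hki⟩, lt_of_le_of_lt hki him, fun h => hne ?_⟩
      rw [← (hW.isSymm N ω.1).apply i k]
      simpa [WignerResolvent.modifyEntries, symMatrix, hik] using h
  have hBp : ∀ p, ((P N).prod (Measure.pi (ν N))).real (B p) ≤ g p.1.1 p.1.2 := fun p => by
    by_cases hp : (p.1.1 : ℕ) < m
    · have h := prob_modified_ne_le (b := fun N p => (p.1.1 : ℕ) < m) hW hL hp hmod
      simp only [hB, hg, hp, true_and, if_true]
      exact h
    · simp [hB, hg, hp]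
  have hrow : ∀ k : Fin N, ∑ l, g k l = if (k : ℕ) < m then F k else 0 := fun k => by
    by_cases hk : (k : ℕ) < m
    · simp only [hg, hk, if_true]
      rw [← Finset.add_sum_erase _ _ (Finset.mem_univ k), if_pos rfl,
        Finset.sum_congr rfl (g := fun l => 2 / L N ^ 4 * J k l) fun l hl => by
          rw [if_neg (Finset.ne_of_mem_erase hl).symm]; ring, ← Finset.mul_sum]
      simp only [hF, rowLindeberg, k.2, dif_pos, Fin.eta, ← hLε]
      rw [hL4]
      simp only [hJ]
      field_simp
    · simp [hg, hk]
  calc _ ≤ ((P N).prod (Measure.pi (ν N))).real (⋃ p, B p) := measureReal_mono hsub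
    _ ≤ ∑ p, ((P N).prod (Measure.pi (ν N))).real (B p) := measureReal_iUnion_fintype_le _
    _ ≤ ∑ p : UpperIndex N, g p.1.1 p.1.2 := Finset.sum_le_sum fun p _ => hBp p
    _ ≤ ∑ k, ∑ l, g k l := sum_upperIndex_le hg0
    _ = ∑ i ∈ Finset.range N, if i < m then F i else 0 := by
        rw [← Fin.sum_univ_eq_sum_range (fun i => if i < m then F i else 0) N]
        exact Finset.sum_congr rfl fun k _ => hrow k
    _ ≤ ∑ i ∈ Finset.range m, F i := by
        rw [← Finset.sum_filter]
        refine Finset.sum_le_sum_of_subset_of_nonneg (fun i hi => ?_) fun i _ _ => hF0 i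
        exact Finset.mem_range.mpr (Finset.mem_filter.mp hi).2

end Modification

end IsWigner

/-! ### Existence of the row truncation -/

/-- Row truncations exist on an enlarged probability space; they are Wigner matrices with
parameters controlled by those of the original one. -/
theorem exists_isRowTruncation {Ω : ℕ → Type u} [∀ N, MeasurableSpace (Ω N)]
    {P : ∀ N, Measure (Ω N)} [∀ N, IsProbabilityMeasure (P N)]
    {W : ∀ N, Ω N → Matrix (Fin N) (Fin N) ℝ} {σ σ₁ m₄ : ℝ} (hW : IsWigner P W σ σ₁ m₄) {m : ℕ}
    (hLin : ∀ i < m, ∀ δ > 0, Tendsto (rowLindeberg P W i δ) atTop (𝓝 0)) :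
    ∃ (Ω' : ℕ → Type u) (_ : ∀ N, MeasurableSpace (Ω' N)) (P' : ∀ N, Measure (Ω' N))
      (π : ∀ N, Ω' N → Ω N) (T : ∀ N, Ω' N → Matrix (Fin N) (Fin N) ℝ) (ε : ℕ → ℝ),
      (∀ N, IsProbabilityMeasure (P' N)) ∧ (∀ N, MeasurePreserving (π N) (P' N) (P N)) ∧
      IsRowTruncation P' (fun N ω => W N (π N ω)) T σ m ε ∧ IsWigner P' T σ σ₁ (8 * m₄) := by
  obtain ⟨ε, hε0, hεt, hεN, hεL⟩ := exists_truncation_levels (rowLindeberg_nonneg P W) hLin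
  set c : ℝ := |σ| + |σ₁| + 1 with hc
  have hc0 : 0 < c := by positivity
  have hc2 : σ ^ 2 + σ₁ ^ 2 ≤ c ^ 2 := by
    rw [hc, ← sq_abs σ, ← sq_abs σ₁]
    nlinarith [abs_nonneg σ, abs_nonneg σ₁, mul_nonneg (abs_nonneg σ) (abs_nonneg σ₁)]
  -- The floor `c` guarantees `E x² ≤ L²` for every `N`; it is inactive for large `N` because `ε N *
  -- N^(1/4)` tends to infinity.
  set L : ℕ → ℝ := fun N => max c (ε N * (N : ℝ) ^ (1 / 4 : ℝ)) with hL
  have hL0 : ∀ N, 0 < L N := fun N => lt_max_of_lt_left hc0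
  have hLev : ∀ᶠ N in atTop, L N = ε N * (N : ℝ) ^ (1 / 4 : ℝ) :=
    (hεN.eventually_ge_atTop c).mono fun N h => max_eq_right h
  have hex : ∀ N (p : UpperIndex N), ∃ (ν : Measure CoinPair.{u}) (τ : ℝ × CoinPair.{u} → ℝ),
      IsEntryModification ((P N).map fun ω => W N ω p.1.1 p.1.2) (L N) ((p.1.1 : ℕ) < m) ν τ :=
    fun N p => by
      have hX := hW.measurable_entry N p.1.1 p.1.2
      have := Measure.isProbabilityMeasure_map (μ := P N) hX.aemeasurable
      refine exists_isEntryModification _ (hL0 N) ?_ ?_ ?_ _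
      · exact (memLp_map_measure_iff aestronglyMeasurable_id hX.aemeasurable).mpr
          (hW.memLp_two N _ _)
      · rw [integral_map hX.aemeasurable (by fun_prop)]
        exact hW.mean_eq_zero N _ _
      · rw [integral_map hX.aemeasurable (by fun_prop)]
        exact (hW.integral_sq_le N _ _).trans
          (hc2.trans (pow_le_pow_left₀ hc0.le (le_max_left _ _) 2))
  choose ν τ hmod using hex
  have hν : ∀ N p, IsProbabilityMeasure (ν N p) := fun N p => (hmod N p).prob
  have hT := hW.modifyEntries hmod
  set P' : ∀ N, Measure (Ω N × (UpperIndex N → CoinPair.{u})) := fun N =>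
    (P N).prod (Measure.pi (ν N)) with hP'
  set T : ∀ N, Ω N × (UpperIndex N → CoinPair.{u}) → Matrix (Fin N) (Fin N) ℝ := fun N ω =>
    modifyEntries (W N ω.1) (τ N) ω.2 with hTdef
  have hP'p : ∀ N, IsProbabilityMeasure (P' N) := fun N => inferInstance
  -- Truncated entries are bounded by `2 L`, not `L`, so the final level is rescaled accordingly.
  -- The maximum with `1` keeps it positive at `N = 0`.
  set ε' : ℕ → ℝ := fun N => 2 * L N / (max N 1 : ℕ) ^ (1 / 4 : ℝ) with hε'
  have hmax : ∀ N : ℕ, (0 : ℝ) < (max N 1 : ℕ) := fun N => by positivity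
  refine ⟨fun N => Ω N × (UpperIndex N → CoinPair.{u}), fun N => inferInstance, P',
    fun N => Prod.fst, T, ε', hP'p, fun N => measurePreserving_fst, ?_, hT⟩
  refine ⟨⟨σ₁, 8 * m₄, hT⟩, fun N => ?_, ?_, fun N ω j k hj hk => ?_, ?_,
    fun N i k _ => hT.mean_eq_zero N i k, fun N i k _ h => hT.offDiag_variance N i k h,
    ⟨σ₁ ^ 2, fun N i _ => ?_⟩, ⟨8 * m₄, fun N i k _ h => hT.offDiag_fourth N i k h⟩,
    fun N ω i k hi => ?_⟩
  · have := hL0 N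
    have := hmax N
    positivity
  · have h2 : Tendsto (fun N => 2 * ε N) atTop (𝓝 0) := by simpa using hεt.const_mul 2
    refine h2.congr' ?_
    filter_upwards [hLev, eventually_ge_atTop 1] with N h hN
    have : (0 : ℝ) < (N : ℝ) ^ (1 / 4 : ℝ) := by positivity
    simp only [hε', h, max_eq_left hN]
    field_simp
  · simp only [hTdef, modifyEntries]
    obtain ⟨p, hp, hp'⟩ := exists_upperIndex j k
    have hpm : ¬ (p.1.1 : ℕ) < m := by
      rcases hp' with hp' | hp' <;> rw [hp'] <;> exact not_lt.mpr ‹_›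
    rw [hp, (hmod N p).eq_fst hpm]
    rcases hp' with hp' | hp'
    · rw [hp']
    · rw [hp']; exact (hW.isSymm N ω.1).apply j k
  · set b : ℕ → ℝ := fun N => ∑ i ∈ Finset.range m,
      (2 * (σ₁ ^ 2 / L N ^ 2) + 2 * (rowLindeberg P W i (ε N) N / ε N ^ 4)) with hb
    have hLt : Tendsto L atTop atTop := tendsto_atTop_mono (fun N => le_max_right _ _) hεN
    have hbt : Tendsto b atTop (𝓝 0) := by
      have h1 : Tendsto (fun N => 2 * (σ₁ ^ 2 / L N ^ 2)) atTop (𝓝 0) := by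
        simpa using (((tendsto_pow_atTop two_ne_zero).comp hLt).const_div_atTop (σ₁ ^ 2)).const_mul 2
      have h2 : Tendsto b atTop (𝓝 (∑ i ∈ Finset.range m, (0 + 2 * 0))) :=
        tendsto_finsetSum _ fun i hi => h1.add ((hεL i (Finset.mem_range.mp hi)).const_mul 2)
      simpa using h2
    have hlow : Tendsto (fun N => ENNReal.ofReal (1 - b N)) atTop (𝓝 1) := by
      have : Tendsto (fun N => 1 - b N) atTop (𝓝 (1 - 0)) := hbt.const_sub 1
      simpa using ENNReal.tendsto_ofReal this
    refine tendsto_of_tendsto_of_tendsto_of_le_of_le' hlow tendsto_const_nhds ?_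
      (Eventually.of_forall fun N => prob_le_one)
    filter_upwards [hLev, eventually_ge_atTop 1] with N h hN
    have h1 := hW.prob_exists_modified_ne_le (hε0 N) hN h (hmod N)
    set S : Set (Ω N × (UpperIndex N → CoinPair.{u})) := {ω | ∀ i k : Fin N, (i : ℕ) < m →
      modifyEntries (W N ω.1) (τ N) ω.2 i k = W N ω.1 i k} with hS
    have h2 : 1 ≤ (P' N).real S + (P' N).real Sᶜ := by
      have := measureReal_union_le (μ := P' N) S Sᶜ
      rwa [Set.union_compl_self, probReal_univ] at this
    exact ENNReal.ofReal_le_of_le_toReal (by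
      change 1 - b N ≤ (P' N).real S
      linarith)
  · rw [variance_of_integral_eq_zero (hT.measurable_entry N i i).aemeasurable (hT.diag_mean N i)]
    exact hT.diag_second N i
  · have hN : 1 ≤ N := i.pos
    have h0 : (0 : ℝ) < (N : ℝ) ^ (1 / 4 : ℝ) := by positivity
    have h1 : ε' N * (N : ℝ) ^ (1 / 4 : ℝ) = 2 * L N := by
      simp only [hε', max_eq_left hN]
      field_simp
    rw [h1]
    simp only [hTdef, modifyEntries, symMatrix]
    split_ifs with hik
    · exact (hmod N ⟨(i, k), hik⟩).abs_le hi _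
    · exact (hmod N ⟨(k, i), (not_le.mp hik).le⟩).abs_le (lt_of_le_of_lt (not_le.mp hik).le hi) _

end WignerResolvent

/-! ### The proposition -/

theorem proposition3p2 :
    ∃ P₄ : Polynomial ℝ, P₄.natDegree = 4 ∧ (∀ l ≤ 4, 0 < P₄.coeff l) ∧
      ∀ σ σ₁ m₄ : ℝ, ∃ C : ℝ, 0 < C ∧
        ∀ (m : ℕ) (Ω : ℕ → Type u) [∀ N, MeasurableSpace (Ω N)]
          (P : ∀ N, Measure (Ω N)) [∀ N, IsProbabilityMeasure (P N)]
          (W : ∀ N, Ω N → Matrix (Fin N) (Fin N) ℝ),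
          WignerResolvent.IsWigner P W σ σ₁ m₄ →
          (∀ i < m, ∀ δ > 0, Tendsto (WignerResolvent.rowLindeberg P W i δ) atTop (𝓝 0)) →
          -- the probability spaces may be enlarged, to make room for extra randomness
          ∃ (Ω' : ℕ → Type u) (_ : ∀ N, MeasurableSpace (Ω' N))
            (P' : ∀ N, Measure (Ω' N)) (π : ∀ N, Ω' N → Ω N)
            (T : ∀ N, Ω' N → Matrix (Fin N) (Fin N) ℝ) (ε : ℕ → ℝ),
            (∀ N, MeasurePreserving (π N) (P' N) (P N)) ∧
            WignerResolvent.IsRowTruncation P' (fun N ω => W N (π N ω)) T σ m ε ∧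
            ∀ (N : ℕ) (i j : Fin N), (i : ℕ) < m → ∀ z : ℂ, z.im ≠ 0 →
              WignerResolvent.cVariance (P' N)
                  (fun ω => WignerResolvent.resolventMatrix (T N ω) z i j) ≤
                C * ((∫ ω, WignerResolvent.opNorm
                        (WignerResolvent.resolventMatrix (T N ω) z) ^ 2 ∂(P' N)) *
                      P₄.eval (|z.im|⁻¹) / N) +
                C * ((∫ ω, WignerResolvent.opNorm
                        (WignerResolvent.resolventMatrix (T N ω) z) ^ (3 / 2 : ℝ) ∂(P' N)) *
                      P₄.eval (|z.im|⁻¹) / N) := by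
  -- The estimate only produces the powers `2` and `4` of `|Im z|⁻¹`; the other terms make all
  -- coefficients positive.
  refine ⟨Polynomial.X ^ 4 + Polynomial.X ^ 3 + Polynomial.X ^ 2 + Polynomial.X + 1,
    by compute_degree!, fun l hl => ?_, fun σ σ₁ m₄ => ?_⟩
  · interval_cases l <;> simp [Polynomial.coeff_X, Polynomial.coeff_one, Polynomial.coeff_X_pow]
  set s : ℝ := σ ^ 2 + σ₁ ^ 2 with hs
  have hs0 : 0 ≤ s := by positivity
  -- The sum of the two coefficients of the variance bound, with fourth-moment bound `8 * m₄` for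
  -- the truncated matrix; the final `1` ensures positivity.
  refine ⟨40 * s + 8 * (96 * s ^ 2 + 16 * |8 * m₄|) + 1, by positivity, ?_⟩
  intro m Ω _ P _ W hW hLin
  obtain ⟨Ω', mΩ', P', π, T, ε, hP', hπ, hTr, hT⟩ :=
    WignerResolvent.exists_isRowTruncation hW hLin
  refine ⟨Ω', mΩ', P', π, T, ε, hπ, hTr, fun N i j _ z hz => ?_⟩
  have hN' : (0 : ℝ) < N := Nat.cast_pos.mpr i.pos
  have h := hT.cVariance_resolvent_le i j hz
  rw [← hs] at h
  simp only [Polynomial.eval_add, Polynomial.eval_pow, Polynomial.eval_X, Polynomial.eval_one]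
  set t := |z.im|⁻¹ with ht
  have ht0 : 0 ≤ t := by positivity
  set Q := ∫ ω, WignerResolvent.opNorm (WignerResolvent.resolventMatrix (T N ω) z) ^ 2 ∂(P' N)
  have hQ0 : 0 ≤ Q := integral_nonneg fun _ => sq_nonneg _
  have hR0 : 0 ≤ ∫ ω, WignerResolvent.opNorm (WignerResolvent.resolventMatrix (T N ω) z) ^
      (3 / 2 : ℝ) ∂(P' N) :=
    integral_nonneg fun _ => Real.rpow_nonneg (WignerResolvent.opNorm_nonneg _) _
  set κ := 8 * (96 * s ^ 2 + 16 * |8 * m₄|) with hκ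
  have hκ0 : 0 ≤ κ := by positivity
  have hpoly : 40 * s * t ^ 2 + κ * t ^ 4 ≤ (40 * s + κ + 1) * (t ^ 4 + t ^ 3 + t ^ 2 + t + 1) := by
    have h1 : t ^ 2 ≤ t ^ 4 + t ^ 3 + t ^ 2 + t + 1 := by
      have : 0 ≤ t ^ 4 + t ^ 3 + t + 1 := by positivity
      linarith
    have h2 : t ^ 4 ≤ t ^ 4 + t ^ 3 + t ^ 2 + t + 1 := by
      have : 0 ≤ t ^ 3 + t ^ 2 + t + 1 := by positivity
      linarith
    have h3 := mul_le_mul_of_nonneg_left h1 (by positivity : 0 ≤ 40 * s)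
    have h4 := mul_le_mul_of_nonneg_left h2 hκ0
    have h5 : 0 ≤ t ^ 4 + t ^ 3 + t ^ 2 + t + 1 := by positivity
    linarith
  refine h.trans (le_add_of_le_of_nonneg ?_ (by positivity))
  rw [← mul_div_assoc, div_le_div_iff_of_pos_right hN']
  calc _ ≤ Q * ((40 * s + κ + 1) * (t ^ 4 + t ^ 3 + t ^ 2 + t + 1)) :=
        mul_le_mul_of_nonneg_left hpoly hQ0
    _ = _ := by ring
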